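/- Let $\mathbb S$ be a standard Borel space, $G_0$ a non-atomic probability measure on $\mathbb S$, $\theta>0$, and let $P\sim\mathrm{DP}(\theta,G_0)$ be a Dirichlet process, that is, $P=\tilde\mu/\tilde\mu(\mathbb S)$ with $\tilde\mu=\sum_{k}J_k\delta_{S_k}$, where $\sum_k\delta_{(J_k,S_k)}$ is a Poisson random measure on $(0,\infty)\times\mathbb S$ with intensity $\theta\,x^{-1}e^{-x}\,dx\,G_0(ds)$. Let $n,J\ge1$ and let $h:\mathbb S\to\{1,\dots,J\}$ be a (jointly measurable) random hash function, independent of $P$, drawn from a strongly universal family in the sense that, for two independent symbols $X,X'\sim G_0$ independent of $h$, the pair $(h(X),h(X'))$ is uniform on $\{1,\dots,J\}^2$. Let $\mathbf c=(c_1,\dots,c_J)$ be a vector of non-negative integers with $\sum_j c_j=n$. For a probability measure $P$ and a hash function $h$, let $X_1,\dots,X_{n+1}$ be i.i.d. from $P$ and put $C_j=\#\{i\le n: h(X_i)=j\}$, $f_{X_{n+1}}=\#\{i\le n: X_i=X_{n+1}\}$, $q_j(P)=P(h^{-1}\{j\})$, $$\pi_j(r;P)=\Pr[f_{X_{n+1}}=r\mid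 \mathbf C_J=\mathbf c,\ h(X_{n+1})=j],$$ $$\varepsilon_k(q;P)=n\sum_{j=1}^J q_j\sum_{r=0}^{c_j}\frac{1}{r+1}\,\pi_j(r;P),$$ and let $\varepsilon_k(P)=\varepsilon_k(q(P);P)$ be the Good–Turing form of the conditional expectation, given the sketch $\mathbf C_J=\mathbf c$, of the number of distinct symbols among $X_1,\dots,X_n$. Then, for almost every $h$, the smoothed cardinality estimator $\hat K_n^{(\mathrm{DP})}$, obtained by averaging $\varepsilon_k(P)$ over $P\sim\mathrm{DP}(\theta,G_0)$ with the bucket probabilities $q_j$ held fixed, is $$\hat K_n^{(\mathrm{DP})}=n\,\frac{\theta}{J}\sum_{j=1}^J\frac{q_j}{1+c_j}\left(\psi\!\left(1+c_j+\frac{\theta}{J}\right)-\psi\!\left(\frac{\theta}{J}\right)\right),$$ where $\psi=(\log\Gamma)'$ is the digamma function, in both of the following senses: (i) $\mathbb E_{P\sim\mathrm{DP}(\theta,G_0)}[\varepsilon_k(q;P)]$ exists and equals the right-hand side for every fixed $q\in\mathbb R^J$ (in particular, for every probability vector $q$); (ii) $\varepsilon_k(P)$ is integrable and its conditional expectation given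 the random vector $q(P)=(q_1(P),\dots,q_J(P))$ is almost surely equal to the right-hand side with $q_j=q_j(P)$. -/

import Mathlib

open MeasureTheory ProbabilityTheory Set
open scoped ENNReal

noncomputable section

namespace SketchDP

/-- The digamma function on the positive half-line: the derivative of `log Γ`. -/
def digamma (x : ℝ) : ℝ := deriv (fun y : ℝ => Real.log (Real.Gamma y)) x

/-! ### The Dirichlet process as a normalized Gamma completely random measure -/

section RandomMeasures

variable {Ω E S : Type*} [MeasurableSpace Ω] [MeasurableSpace E] [MeasurableSpace S]

/-- `N` is a Poisson random measure on `E` with intensity `ν`: the counts of measurable sets are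
Poisson distributed with parameter `ν A` (and a.s. infinite if `ν A = ∞`), and the counts of
pairwise disjoint sets are independent. -/
structure IsPoissonRandomMeasure (μ : Measure Ω) (N : Ω → Measure E) (ν : Measure E) : Prop where
  measurable : Measurable N
  count_law : ∀ A : Set E, MeasurableSet A → ν A ≠ ∞ →
    ∀ k : ℕ, μ {ω | N ω A = (k : ℝ≥0∞)} = poissonMeasure (ν A).toNNReal {k}
  count_infinite : ∀ A : Set E, MeasurableSet A → ν A = ∞ → ∀ᵐ ω ∂μ, N ω A = ∞
  indep : ∀ (m : ℕ) (A : Fin m → Set E), (∀ i, MeasurableSet (A i)) →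
    Pairwise (Function.onFun Disjoint A) → iIndepFun (fun i ω => N ω (A i)) μ

/-- The Lévy intensity `ν(dx, ds) = θ (e^{-x} / x) dx G₀(ds)` of the Gamma process, on the half
space `x > 0`. -/
def gammaIntensity (θ : ℝ) (G₀ : Measure S) : Measure (ℝ × S) :=
  ENNReal.ofReal θ • (((volume.restrict (Ioi (0 : ℝ))).withDensity
    (fun x => ENNReal.ofReal (Real.exp (-x) / x))).prod G₀)

/-- The point measure `∑ₖ δ_(Jₖ, Sₖ)` of a sequence of points `(Jₖ, Sₖ)`. -/
def pointMeasure (p : ℕ → ℝ × S) : Measure (ℝ × S) :=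
  Measure.sum fun k => Measure.dirac (p k)

/-- The discrete measure `∑ₖ Jₖ δ_Sₖ` with jumps `Jₖ` and locations `Sₖ`. -/
def jumpMeasure (p : ℕ → ℝ × S) : Measure S :=
  Measure.sum fun k => ENNReal.ofReal (p k).1 • Measure.dirac (p k).2

/-- `Q` is the law `DP(θ, G₀)` on the space of measures on `S`: the law of `μ̃ / μ̃(S)`, where
`μ̃ = ∑ₖ Jₖ δ_Sₖ` and `∑ₖ δ_(Jₖ, Sₖ)` is a Poisson random measure with the Gamma intensity.
(The law does not depend on the probability space that carries the points.) -/
def IsDirichletProcessLaw (θ : ℝ) (G₀ : Measure S) (Q : Measure (Measure S)) : Prop :=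
  ∃ (Ω : Type) (_ : MeasurableSpace Ω) (μ : Measure Ω) (_ : IsProbabilityMeasure μ)
    (p : ℕ → Ω → ℝ × S), (∀ k, Measurable (p k)) ∧
    IsPoissonRandomMeasure μ (fun ω => pointMeasure fun k => p k ω) (gammaIntensity θ G₀) ∧
    Q = μ.map (fun ω =>
      (jumpMeasure (fun k => p k ω) univ)⁻¹ • jumpMeasure (fun k => p k ω))

end RandomMeasures

/-! ### Random hashing -/

section Hash

variable {S H : Type*} [MeasurableSpace S] [MeasurableSpace H] {J : ℕ}

/-- Strong universality (pairwise independence and uniformity) of a random hash function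
`s ↦ h ι s`, `ι ∼ lam`, tested on pairs of independent symbols drawn from `G₀`, independently of
the hash function: the two hash values are independent and uniform on the `J` buckets. -/
def IsStronglyUniversalFor (lam : Measure H) (h : H → S → Fin J) (G₀ : Measure S) : Prop :=
  ∀ j₁ j₂ : Fin J,
    (lam.prod (G₀.prod G₀)) {z | h z.1 z.2.1 = j₁ ∧ h z.1 z.2.2 = j₂} = ((J : ℝ≥0∞) ^ 2)⁻¹

/-- Strong universality on all pairs of distinct fixed symbols implies the property above, for
every non-atomic `G₀`: two independent symbols from `G₀` are a.s. distinct. -/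
theorem IsStronglyUniversalFor.of_pairwise [MeasurableEq S] (lam : Measure H)
    [IsProbabilityMeasure lam] (h : H → S → Fin J) (hh : Measurable (Function.uncurry h))
    (G₀ : Measure S) [IsProbabilityMeasure G₀] [NullSingletonClass G₀]
    (hpair : ∀ s t : S, s ≠ t → ∀ j₁ j₂ : Fin J,
      lam {ι | h ι s = j₁ ∧ h ι t = j₂} = ((J : ℝ≥0∞) ^ 2)⁻¹) :
    IsStronglyUniversalFor lam h G₀ := by
  intro j₁ j₂
  have h1 : Measurable fun z : H × S × S => h z.1 z.2.1 :=
    hh.comp (measurable_fst.prodMk (measurable_fst.comp measurable_snd))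
  have h2 : Measurable fun z : H × S × S => h z.1 z.2.2 :=
    hh.comp (measurable_fst.prodMk (measurable_snd.comp measurable_snd))
  have hm : MeasurableSet {z : H × S × S | h z.1 z.2.1 = j₁ ∧ h z.1 z.2.2 = j₂} :=
    (h1 (measurableSet_singleton j₁)).inter (h2 (measurableSet_singleton j₂))
  have hd : ∀ᵐ y ∂(G₀.prod G₀), y.1 ≠ y.2 := by
    have hD : MeasurableSet {y : S × S | y.1 = y.2} := measurableSet_eq_fun
      measurable_fst measurable_snd
    rw [ae_iff]
    simp only [ne_eq, not_not]
    rw [Measure.prod_apply hD]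
    simp
  rw [Measure.prod_apply_symm hm, lintegral_congr_ae (g := fun _ => ((J : ℝ≥0∞) ^ 2)⁻¹)]
  · simp
  · filter_upwards [hd] with y hy
    exact hpair y.1 y.2 hy j₁ j₂

end Hash

/-! ### Sampling, the sketch, and the cardinality functional -/

section Sketch

variable {S : Type*} {J n : ℕ}

open Classical in
/-- The sketch `C_j = ∑_{i ≤ n} I[h(x_i) = j]` of the first `n` entries of `(x_1, …, x_{n+1})`. -/
def sketch (h : S → Fin J) (x : Fin (n + 1) → S) (j : Fin J) : ℕ :=
  (Finset.univ.filter fun i : Fin n => h (x i.castSucc) = j).card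

open Classical in
/-- The empirical frequency `f_{x_{n+1}}` of `x_{n+1}` among `x_1, …, x_n`. -/
def queryFrequency (x : Fin (n + 1) → S) : ℕ :=
  (Finset.univ.filter fun i : Fin n => x i.castSucc = x (Fin.last n)).card

variable [MeasurableSpace S]

/-- `π_j(r; P) = Pr[f_{X_{n+1}} = r | C_J = c, h(X_{n+1}) = j]` for `X_1, …, X_{n+1}` i.i.d.
from `P` and the hash function `h`. -/
def frequencyProb (h : S → Fin J) (n : ℕ) (c : Fin J → ℕ) (j : Fin J) (r : ℕ)
    (P : Measure S) : ℝ :=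
  (cond (Measure.pi fun _ : Fin (n + 1) => P)
    {x | sketch h x = c ∧ h (x (Fin.last n)) = j}).real {x | queryFrequency x = r}

/-- The bucket probability `q_j = Pr[h(X_i) = j]`, `X_i ∼ P`. -/
def bucketProb (h : S → Fin J) (P : Measure S) (j : Fin J) : ℝ := P.real (h ⁻¹' {j})

/-- The functional `n ∑_j q_j ∑_{r=0}^{c_j} π_j(r; P) / (r + 1)`, with the bucket probabilities
`q` as a separate argument. -/
def cardinalityFunctional (h : S → Fin J) (n : ℕ) (c : Fin J → ℕ) (q : Fin J → ℝ)
    (P : Measure S) : ℝ :=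
  n * ∑ j, q j * ∑ r ∈ Finset.range (c j + 1), 1 / ((r : ℝ) + 1) * frequencyProb h n c j r P

/-- `ε_k(P)`, the Good-Turing form of the conditional expectation of the number of distinct
symbols given the sketch: the functional above at the bucket probabilities of `P` itself. -/
def epsilonK (h : S → Fin J) (n : ℕ) (c : Fin J → ℕ) (P : Measure S) : ℝ :=
  cardinalityFunctional h n c (bucketProb h P) P

end Sketch

end SketchDP

end

open SketchDP

/-!
Let `α_j = θ G₀(h⁻¹{j})`. The Gamma process puts independent masses of law `Gamma(α_j)` on the
buckets. Mecke's formula for the Poisson process, compared with the Laplace transforms of these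
masses, shows that given all bucket probabilities a size-biased atom of `P` inside bucket `j` still
carries a `Beta(1, α_j)` share of the bucket. Hence `i` further draws from the bucket all miss it
with conditional probability `α_j / (α_j + i)`. For fixed `P`, writing `1 / (r + 1) = ∫₀¹ uʳ du`
turns the Good–Turing sum into the average of these missing probabilities over `0 ≤ i ≤ c_j`, and
`∑ i ≤ c_j, 1 / (α_j + i)` is a difference of digamma values. Strong universality makes each
`G₀(h⁻¹{j})` a random variable with mean `1 / J` and variance zero, so that `α_j = θ / J` almost
surely.
-/

noncomputable section

namespace SketchDP

open Filter Topology
open scoped NNReal BoundedContinuousFunction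

/-- The function `x ↦ e^{-x}` on `[0, ∞]`, with `e^{-∞} = 0`, in terms of which Laplace transforms
are written. -/
def expNeg (x : ℝ≥0∞) : ℝ≥0∞ := EReal.exp (-(x : EReal))

@[simp] lemma expNeg_zero : expNeg 0 = 1 := by simp [expNeg]

@[simp] lemma expNeg_top : expNeg ∞ = 0 := by simp [expNeg]

lemma expNeg_coe (x : ℝ≥0) : expNeg x = ENNReal.ofReal (Real.exp (-x)) := by
  rw [expNeg, ← EReal.exp_coe]
  rfl

lemma expNeg_ofReal {x : ℝ} (hx : 0 ≤ x) :
    expNeg (ENNReal.ofReal x) = ENNReal.ofReal (Real.exp (-x)) := by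
  rw [ENNReal.ofReal, expNeg_coe, Real.coe_toNNReal x hx]

lemma expNeg_add (x y : ℝ≥0∞) : expNeg (x + y) = expNeg x * expNeg y := by
  rw [expNeg, expNeg, expNeg, ← EReal.exp_add, EReal.coe_ennreal_add,
    EReal.neg_add (by simp) (by simp), sub_eq_add_neg]

lemma antitone_expNeg : Antitone expNeg := fun _ _ hxy =>
  EReal.exp_monotone (EReal.neg_le_neg_iff.2 (EReal.coe_ennreal_le_coe_ennreal_iff.2 hxy))

lemma expNeg_le_one (x : ℝ≥0∞) : expNeg x ≤ 1 := by
  simpa only [expNeg_zero] using antitone_expNeg (zero_le (a := x))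

lemma expNeg_ne_top (x : ℝ≥0∞) : expNeg x ≠ ∞ :=
  ne_top_of_le_ne_top ENNReal.one_ne_top (expNeg_le_one x)

lemma expNeg_eq_one_iff {x : ℝ≥0∞} : expNeg x = 1 ↔ x = 0 := by
  rw [expNeg, ← EReal.exp_zero, EReal.exp_strictMono.injective.eq_iff]
  simp

lemma continuous_expNeg : Continuous expNeg :=
  ENNReal.continuous_exp.comp (continuous_neg.comp continuous_coe_ennreal_ereal)

@[fun_prop] lemma measurable_expNeg : Measurable expNeg := continuous_expNeg.measurable

lemma expNeg_sum {ι : Type*} (s : Finset ι) (f : ι → ℝ≥0∞) :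
    expNeg (∑ i ∈ s, f i) = ∏ i ∈ s, expNeg (f i) := by
  classical
  induction s using Finset.induction_on with
  | empty => simp
  | insert a s ha ih => rw [Finset.sum_insert ha, Finset.prod_insert ha, expNeg_add, ih]

lemma expNeg_mul_nat (x : ℝ≥0∞) (k : ℕ) : expNeg (x * k) = expNeg x ^ k := by
  induction k with
  | zero => simp
  | succ k ih => rw [Nat.cast_succ, mul_add, mul_one, expNeg_add, ih, pow_succ]

lemma one_sub_expNeg_le (x : ℝ≥0∞) : 1 - expNeg x ≤ x := by
  induction x using ENNReal.recTopCoe with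
  | top => simp
  | coe x =>
    rw [expNeg_coe, ← ENNReal.ofReal_one, ← ENNReal.ofReal_sub _ (Real.exp_nonneg _)]
    exact ENNReal.ofReal_le_of_le_toReal (by simpa [add_comm] using Real.one_sub_le_exp_neg (x : ℝ))

lemma mul_expNeg_le (x : ℝ≥0∞) : x * expNeg x ≤ 1 - expNeg x := by
  induction x using ENNReal.recTopCoe with
  | top => simp
  | coe x =>
    have h : (x : ℝ) * Real.exp (-x) ≤ 1 - Real.exp (-x) := by
      have hx := mul_le_mul_of_nonneg_right (Real.add_one_le_exp (x : ℝ)) (Real.exp_nonneg (-x))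
      rw [← Real.exp_add, add_neg_cancel, Real.exp_zero] at hx
      linarith
    rw [expNeg_coe, ← ENNReal.ofReal_one, ← ENNReal.ofReal_sub _ (Real.exp_nonneg _),
      ← ENNReal.ofReal_coe_nnreal, ← ENNReal.ofReal_mul x.coe_nonneg]
    exact ENNReal.ofReal_le_ofReal h

/-- The difference quotient `(1 - e^{-t b}) / t` at `t = 2⁻ᵐ`. It increases to `b`, and along dyadic
steps this needs only `1 - y² ≤ 2 (1 - y)`. -/
def expQuot (m : ℕ) (b : ℝ≥0∞) : ℝ≥0∞ := 2 ^ m * (1 - expNeg (b / 2 ^ m))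

@[fun_prop] lemma measurable_expQuot (m : ℕ) : Measurable (expQuot m) := by
  unfold expQuot
  fun_prop

lemma expQuot_mono_left (b : ℝ≥0∞) : Monotone fun m => expQuot m b := by
  refine monotone_nat_of_le_succ fun m => ?_
  have hhalf : b / 2 ^ m = b / 2 ^ (m + 1) + b / 2 ^ (m + 1) := by
    rw [pow_succ, div_eq_mul_inv, div_eq_mul_inv, ENNReal.mul_inv (by simp) (by simp), ← mul_assoc,
      ← div_eq_mul_inv _ 2, ENNReal.add_halves]
  have hsq : ∀ y : ℝ≥0∞, y ≠ ∞ → y ≤ 1 → 1 - y * y ≤ 2 * (1 - y) := fun y hy hy1 =>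
    calc 1 - y * y ≤ (1 - y) + (y - y * y) := tsub_le_tsub_add_tsub
      _ = (1 - y) + y * (1 - y) := by rw [ENNReal.mul_sub fun _ _ => hy, mul_one]
      _ ≤ (1 - y) + 1 * (1 - y) := by gcongr
      _ = 2 * (1 - y) := by ring
  simp only [expQuot]
  rw [hhalf, expNeg_add, pow_succ, mul_assoc]
  gcongr
  exact hsq _ (expNeg_ne_top _) (expNeg_le_one _)

lemma expQuot_mono_right (m : ℕ) : Monotone (expQuot m) := fun a b hab => by
  unfold expQuot
  gcongr
  exact antitone_expNeg (by gcongr)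

lemma expQuot_le (m : ℕ) (b : ℝ≥0∞) : expQuot m b ≤ b :=
  calc expQuot m b ≤ 2 ^ m * (b / 2 ^ m) := by
        unfold expQuot
        gcongr
        exact one_sub_expNeg_le _
    _ = b := ENNReal.mul_div_cancel (by simp) (by simp)

lemma mul_expNeg_le_expQuot (m : ℕ) (b : ℝ≥0∞) : b * expNeg (b / 2 ^ m) ≤ expQuot m b :=
  calc b * expNeg (b / 2 ^ m) = 2 ^ m * (b / 2 ^ m * expNeg (b / 2 ^ m)) := by
        rw [← mul_assoc, ENNReal.mul_div_cancel (by simp) (by simp)]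
    _ ≤ expQuot m b := by
        unfold expQuot
        gcongr
        exact mul_expNeg_le _

lemma tendsto_two_pow_atTop : Tendsto (fun m : ℕ => (2 : ℝ≥0∞) ^ m) atTop (𝓝 ∞) :=
  ENNReal.tendsto_pow_atTop_nhds_top_iff.2 (by norm_num)

lemma iSup_expQuot (b : ℝ≥0∞) : ⨆ m, expQuot m b = b := by
  refine le_antisymm (iSup_le fun m => expQuot_le m b) ?_
  rcases eq_or_ne b ∞ with rfl | hb
  · refine le_of_tendsto' tendsto_two_pow_atTop fun m => le_iSup_of_le m ?_
    simp [expQuot, ENNReal.top_div]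
  · have hdiv : Tendsto (fun m : ℕ => b / 2 ^ m) atTop (𝓝 0) := by
      simpa using ENNReal.Tendsto.const_div tendsto_two_pow_atTop (Or.inr hb)
    have hlim : Tendsto (fun m : ℕ => b * expNeg (b / 2 ^ m)) atTop (𝓝 b) := by
      simpa using ENNReal.Tendsto.const_mul ((continuous_expNeg.tendsto 0).comp hdiv) (Or.inr hb)
    exact le_of_tendsto' hlim fun m => le_iSup_of_le m (mul_expNeg_le_expQuot m b)

lemma iSup_expQuot_of_monotone {d : ℕ → ℝ≥0∞} (hd : Monotone d) :
    ⨆ m, expQuot m (d m) = ⨆ m, d m := by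
  refine le_antisymm (iSup_mono fun m => expQuot_le m (d m)) (iSup_le fun k => ?_)
  rw [← iSup_expQuot (d k)]
  exact iSup_le fun m => le_iSup_of_le (max m k)
    ((expQuot_mono_left _ (le_max_left m k)).trans (expQuot_mono_right _ (hd (le_max_right m k))))

lemma expNeg_mul_expQuot (m : ℕ) (a b : ℝ≥0∞) :
    expNeg a * expQuot m b = 2 ^ m * (expNeg a - expNeg (a + b / 2 ^ m)) := by
  rw [expQuot, mul_left_comm, ENNReal.mul_sub fun _ _ => expNeg_ne_top a, mul_one, expNeg_add]

lemma one_sub_expNeg_add (m : ℕ) (a b : ℝ≥0∞) :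
    1 - expNeg (a + b / 2 ^ m) = (1 - expNeg a) + expNeg a * expQuot m b / 2 ^ m := by
  rw [expNeg_mul_expQuot, mul_comm, ENNReal.mul_div_cancel_right (by simp) (by simp),
    tsub_add_tsub_cancel (expNeg_le_one _) (antitone_expNeg le_self_add)]

lemma lintegral_expNeg_mul_eq_iSup {X : Type*} [MeasurableSpace X] {ρ : Measure X}
    {a b : X → ℝ≥0∞} (ha : Measurable a) (hb : Measurable b) :
    ∫⁻ x, expNeg (a x) * b x ∂ρ = ⨆ m, ∫⁻ x, expNeg (a x) * expQuot m (b x) ∂ρ := by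
  have hmono : Monotone fun (m : ℕ) x => expNeg (a x) * expQuot m (b x) := fun _ _ hij x =>
    mul_le_mul_right (expQuot_mono_left (b x) hij) _
  rw [← lintegral_iSup (fun m => by fun_prop) hmono]
  exact lintegral_congr fun x => by rw [← ENNReal.mul_iSup, iSup_expQuot]

lemma lintegral_pow_poissonMeasure (r : ℝ≥0) {y : ℝ≥0} (hy : y ≤ 1) :
    ∫⁻ k, (y : ℝ≥0∞) ^ k ∂poissonMeasure r = expNeg (r * (1 - y)) := by
  have hterm : ∀ k : ℕ, (y : ℝ≥0∞) ^ k * poissonMeasure r {k} =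
      ENNReal.ofReal (Real.exp (-r) * ((r * y : ℝ) ^ k / k.factorial)) := fun k => by
    rw [poissonMeasure_singleton, ← ENNReal.ofReal_coe_nnreal (p := y),
      ← ENNReal.ofReal_pow (by positivity), ← ENNReal.ofReal_mul (by positivity)]
    congr 1
    ring
  have hsum : HasSum (fun k : ℕ => Real.exp (-r) * ((r * y : ℝ) ^ k / k.factorial))
      (Real.exp (-r) * Real.exp (r * y)) := by
    rw [Real.exp_eq_exp_ℝ]
    exact (NormedSpace.expSeries_div_hasSum_exp (r * y : ℝ)).mul_left _
  rw [lintegral_countable']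
  simp_rw [hterm]
  rw [← ENNReal.ofReal_tsum_of_nonneg (fun k => by positivity) hsum.summable, hsum.tsum_eq,
    ← Real.exp_add, ← ENNReal.coe_one, ← ENNReal.coe_sub, ← ENNReal.coe_mul, expNeg_coe,
    NNReal.coe_mul, NNReal.coe_sub hy]
  congr 2
  push_cast
  ring

lemma poissonMeasure_compl_zero_one_le (r : ℝ≥0) :
    poissonMeasure r {0, 1}ᶜ ≤ (r : ℝ≥0∞) ^ 2 := by
  have h01 : (poissonMeasure r).real {0, 1} = Real.exp (-r) * (1 + r) := by
    rw [insert_eq, measureReal_union (by simp) (by simp)]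
    simp [poissonMeasure_real_singleton, mul_add]
  have hexp : (1 - r : ℝ) * (1 + r) ≤ Real.exp (-r) * (1 + r) := by
    gcongr
    exact Real.one_sub_le_exp_neg r
  have hreal : (poissonMeasure r).real {0, 1}ᶜ ≤ (r : ℝ) ^ 2 := by
    rw [probReal_compl_eq_one_sub (by measurability), h01]
    linarith
  rw [← ofReal_measureReal, ← ENNReal.ofReal_coe_nnreal, ← ENNReal.ofReal_pow r.coe_nonneg]
  exact ENNReal.ofReal_le_ofReal hreal

namespace IsPoissonRandomMeasure

variable {Ω E : Type*} [MeasurableSpace Ω] [MeasurableSpace E] {μ : Measure Ω}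
  {N : Ω → Measure E} {ν : Measure E}

lemma measurable_apply (hN : IsPoissonRandomMeasure μ N ν) {A : Set E} (hA : MeasurableSet A) :
    Measurable fun ω => N ω A :=
  (Measure.measurable_coe hA).comp hN.measurable

lemma measurable_lintegral (hN : IsPoissonRandomMeasure μ N ν) {f : E → ℝ≥0∞}
    (hf : Measurable f) : Measurable fun ω => ∫⁻ x, f x ∂(N ω) :=
  (Measure.measurable_lintegral hf).comp hN.measurable

variable [IsProbabilityMeasure μ]

lemma map_apply_eq (hN : IsPoissonRandomMeasure μ N ν) {A : Set E} (hA : MeasurableSet A)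
    (hν : ν A ≠ ∞) :
    μ.map (fun ω => N ω A) = (poissonMeasure (ν A).toNNReal).map (fun k : ℕ => (k : ℝ≥0∞)) := by
  have hcount : ∀ k : ℕ, MeasurableSet {ω | N ω A = k} := fun k =>
    hN.measurable_apply hA (measurableSet_singleton _)
  have := Measure.isProbabilityMeasure_map (μ := μ) (hN.measurable_apply hA).aemeasurable
  have := Measure.isProbabilityMeasure_map (μ := poissonMeasure (ν A).toNNReal)
    (f := fun k : ℕ => (k : ℝ≥0∞)) .of_discrete
  refine (Measure.eq_of_le_of_isProbabilityMeasure (Measure.le_iff.2 fun B hB => ?_)).symm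
  rw [Measure.map_apply .of_discrete hB, Measure.map_apply (hN.measurable_apply hA) hB]
  set K : Set ℕ := (fun k : ℕ => (k : ℝ≥0∞)) ⁻¹' B
  calc poissonMeasure (ν A).toNNReal K
      = ∑' k : K, μ {ω | N ω A = (k : ℕ)} := by
        simp_rw [hN.count_law A hA hν]
        exact (Measure.tsum_indicator_apply_singleton _ K .of_discrete).symm.trans
          (tsum_subtype K fun k => poissonMeasure (ν A).toNNReal {k}).symm
    _ = μ (⋃ k : K, {ω | N ω A = (k : ℕ)}) := by
        refine (measure_iUnion (fun k l hkl => ?_) fun k : K => hcount k).symm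
        refine Set.disjoint_left.2 fun ω hk hl => hkl (Subtype.ext ?_)
        exact_mod_cast (show N ω A = (k : ℕ) from hk).symm.trans hl
    _ ≤ μ ((fun ω => N ω A) ⁻¹' B) :=
        measure_mono <| iUnion_subset fun k ω (hω : N ω A = (k : ℕ)) =>
          (congrArg (· ∈ B) hω).mpr k.2

lemma measure_apply_notMem_zero_one_le (hN : IsPoissonRandomMeasure μ N ν) {A : Set E}
    (hA : MeasurableSet A) : μ {ω | N ω A ∉ ({0, 1} : Set ℝ≥0∞)} ≤ ν A ^ 2 := by
  rcases eq_or_ne (ν A) ∞ with hν | hν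
  · simp [hν]
  have hset : MeasurableSet ({0, 1} : Set ℝ≥0∞)ᶜ := by measurability
  calc μ {ω | N ω A ∉ ({0, 1} : Set ℝ≥0∞)}
      = μ.map (fun ω => N ω A) {0, 1}ᶜ :=
        (Measure.map_apply (hN.measurable_apply hA) hset).symm
    _ = poissonMeasure (ν A).toNNReal {0, 1}ᶜ := by
        rw [hN.map_apply_eq hA hν, Measure.map_apply .of_discrete hset]
        congr 1
        ext k
        simp
    _ ≤ ν A ^ 2 := by
        simpa only [ENNReal.coe_toNNReal hν] using poissonMeasure_compl_zero_one_le (ν A).toNNReal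

lemma lintegral_expNeg_mul (hN : IsPoissonRandomMeasure μ N ν) {A : Set E} (hA : MeasurableSet A)
    (x : ℝ≥0∞) : ∫⁻ ω, expNeg (x * N ω A) ∂μ = expNeg ((1 - expNeg x) * ν A) := by
  rcases eq_or_ne x 0 with rfl | hx
  · simp
  rcases eq_or_ne (ν A) ∞ with hν | hν
  · have hne : 1 - expNeg x ≠ 0 := by
      rw [ne_eq, tsub_eq_zero_iff_le, not_le]
      exact (expNeg_le_one x).lt_of_ne (expNeg_eq_one_iff.not.2 hx)
    rw [hν, ENNReal.mul_top hne, expNeg_top, lintegral_congr_ae (g := fun _ => 0), lintegral_zero]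
    filter_upwards [hN.count_infinite A hA hν] with ω hω
    rw [hω, ENNReal.mul_top hx, expNeg_top]
  · have hle : (expNeg x).toNNReal ≤ 1 :=
      ENNReal.toNNReal_mono ENNReal.one_ne_top (expNeg_le_one x)
    calc ∫⁻ ω, expNeg (x * N ω A) ∂μ
        = ∫⁻ y, expNeg (x * y) ∂μ.map fun ω => N ω A :=
          (lintegral_map (f := fun y => expNeg (x * y)) (by fun_prop) (hN.measurable_apply hA)).symm
      _ = ∫⁻ k, ((expNeg x).toNNReal : ℝ≥0∞) ^ k ∂poissonMeasure (ν A).toNNReal := by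
          rw [hN.map_apply_eq hA hν, lintegral_map (by fun_prop) .of_discrete]
          simp_rw [expNeg_mul_nat, ENNReal.coe_toNNReal (expNeg_ne_top x)]
      _ = expNeg ((1 - expNeg x) * ν A) := by
          rw [lintegral_pow_poissonMeasure _ hle, ENNReal.coe_toNNReal hν,
            ENNReal.coe_toNNReal (expNeg_ne_top x), mul_comm]

lemma lintegral_expNeg_simpleFunc (hN : IsPoissonRandomMeasure μ N ν) (g : SimpleFunc E ℝ≥0∞) :
    ∫⁻ ω, expNeg (∫⁻ x, g x ∂(N ω)) ∂μ = expNeg (∫⁻ x, (1 - expNeg (g x)) ∂ν) := by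
  let e := g.range.equivFin.symm
  let A : Fin g.range.card → Set E := fun i => g ⁻¹' {(e i : ℝ≥0∞)}
  have hA : ∀ i, MeasurableSet (A i) := fun i => g.measurableSet_fiber _
  have hdisj : Pairwise (Function.onFun Disjoint A) := fun i j hij =>
    disjoint_left.2 fun x hi hj => hij (e.injective (Subtype.ext (Eq.trans (Eq.symm hi) hj)))
  have hsum : ∀ F : ℝ≥0∞ → Set E → ℝ≥0∞, ∑ x ∈ g.range, F x (g ⁻¹' {x}) = ∑ i, F (e i) (A i) :=
    fun F => by
      rw [← Finset.sum_coe_sort g.range fun x => F x (g ⁻¹' {x}), ← Equiv.sum_comp e]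
  have hind : iIndepFun (fun i ω => expNeg (e i * N ω (A i))) μ :=
    (hN.indep _ A hA hdisj).comp (fun i y => expNeg (e i * y)) fun i => by fun_prop
  calc ∫⁻ ω, expNeg (∫⁻ x, g x ∂(N ω)) ∂μ
      = ∫⁻ ω, ∏ i, expNeg (e i * N ω (A i)) ∂μ := lintegral_congr fun ω => by
        rw [SimpleFunc.lintegral_eq_lintegral, SimpleFunc.lintegral, hsum fun x B => x * N ω B,
          expNeg_sum]
    _ = ∏ i, ∫⁻ ω, expNeg (e i * N ω (A i)) ∂μ :=
        lintegral_prod_eq_prod_lintegral_of_indepFun Finset.univ _ hind fun i =>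
          measurable_expNeg.comp ((hN.measurable_apply (hA i)).const_mul _)
    _ = expNeg (∑ i, (1 - expNeg (e i)) * ν (A i)) := by
        simp_rw [hN.lintegral_expNeg_mul (hA _), expNeg_sum]
    _ = expNeg (∫⁻ x, (1 - expNeg (g x)) ∂ν) := by
        rw [← hsum fun x B => (1 - expNeg x) * ν B, ← SimpleFunc.map_lintegral,
          ← SimpleFunc.lintegral_eq_lintegral]
        rfl

lemma lintegral_expNeg (hN : IsPoissonRandomMeasure μ N ν) {g : E → ℝ≥0∞} (hg : Measurable g) :
    ∫⁻ ω, expNeg (∫⁻ x, g x ∂(N ω)) ∂μ = expNeg (∫⁻ x, (1 - expNeg (g x)) ∂ν) := by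
  let G := SimpleFunc.eapprox g
  have hG : ∀ m, Measurable (G m) := fun m => (G m).measurable
  have hmono : ∀ x, Monotone fun m => G m x := fun x _ _ hij => SimpleFunc.monotone_eapprox g hij x
  have hlim : ∀ x, Tendsto (fun m => G m x) atTop (𝓝 (g x)) := fun x => by
    simpa only [G, SimpleFunc.iSup_eapprox_apply hg] using tendsto_atTop_iSup (hmono x)
  have hleft : Tendsto (fun m => ∫⁻ ω, expNeg (∫⁻ x, G m x ∂(N ω)) ∂μ) atTop
      (𝓝 (∫⁻ ω, expNeg (∫⁻ x, g x ∂(N ω)) ∂μ)) :=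
    tendsto_lintegral_of_dominated_convergence (fun _ => 1)
      (fun m => measurable_expNeg.comp (hN.measurable_lintegral (hG m)))
      (fun m => ae_of_all _ fun ω => expNeg_le_one _) (by simp) <| ae_of_all _ fun ω =>
        (continuous_expNeg.tendsto _).comp <| lintegral_tendsto_of_tendsto_of_monotone
          (fun m => (hG m).aemeasurable) (ae_of_all _ hmono) (ae_of_all _ hlim)
  have hright : Tendsto (fun m => expNeg (∫⁻ x, (1 - expNeg (G m x)) ∂ν)) atTop
      (𝓝 (expNeg (∫⁻ x, (1 - expNeg (g x)) ∂ν))) :=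
    (continuous_expNeg.tendsto _).comp <| lintegral_tendsto_of_tendsto_of_monotone
      (fun m => (by fun_prop : Measurable fun x => 1 - expNeg (G m x)).aemeasurable)
      (ae_of_all _ fun x _ _ hij => tsub_le_tsub_left (antitone_expNeg (hmono x hij)) _)
      (ae_of_all _ fun x => ENNReal.Tendsto.sub tendsto_const_nhds
        ((continuous_expNeg.tendsto _).comp (hlim x)) (Or.inl ENNReal.one_ne_top))
  refine tendsto_nhds_unique hleft ?_
  simp_rw [hN.lintegral_expNeg_simpleFunc]
  exact hright

lemma lintegral_expNeg_mul_expQuot (hN : IsPoissonRandomMeasure μ N ν) {f g : E → ℝ≥0∞}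
    (hf : Measurable f) (hg : Measurable g) (m : ℕ) :
    ∫⁻ ω, expNeg (∫⁻ x, g x ∂(N ω)) * expQuot m (∫⁻ x, f x ∂(N ω)) ∂μ =
      expNeg (∫⁻ x, (1 - expNeg (g x)) ∂ν) *
        expQuot m (∫⁻ x, expNeg (g x) * expQuot m (f x) ∂ν) := by
  have hNf := hN.measurable_lintegral hf
  have hNg := hN.measurable_lintegral hg
  have hintensity : ∫⁻ x, (1 - expNeg (g x + f x / 2 ^ m)) ∂ν =
      ∫⁻ x, (1 - expNeg (g x)) ∂ν + (∫⁻ x, expNeg (g x) * expQuot m (f x) ∂ν) / 2 ^ m := by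
    simp_rw [one_sub_expNeg_add, div_eq_mul_inv]
    rw [lintegral_add_left (by fun_prop), lintegral_mul_const _ (by fun_prop)]
  have hsum : ∀ ω, ∫⁻ x, g x ∂(N ω) + (∫⁻ x, f x ∂(N ω)) / 2 ^ m =
      ∫⁻ x, g x + f x / 2 ^ m ∂(N ω) := fun ω => by
    simp_rw [div_eq_mul_inv]
    rw [lintegral_add_left hg, lintegral_mul_const _ hf]
  simp_rw [expNeg_mul_expQuot] at hintensity ⊢
  rw [← hintensity, ← hN.lintegral_expNeg hg, ← hN.lintegral_expNeg (by fun_prop),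
    lintegral_const_mul _ (by fun_prop), lintegral_sub]
  · simp_rw [hsum]
  · fun_prop
  · exact ((lintegral_mono fun ω => expNeg_le_one _).trans_lt (by simp)).ne
  · exact ae_of_all _ fun ω => antitone_expNeg le_self_add

/-- Mecke's formula, for exponential functionals. -/
lemma lintegral_expNeg_mul_lintegral (hN : IsPoissonRandomMeasure μ N ν) {f g : E → ℝ≥0∞}
    (hf : Measurable f) (hg : Measurable g) :
    ∫⁻ ω, expNeg (∫⁻ x, g x ∂(N ω)) * ∫⁻ x, f x ∂(N ω) ∂μ =
      expNeg (∫⁻ x, (1 - expNeg (g x)) ∂ν) * ∫⁻ x, expNeg (g x) * f x ∂ν := by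
  have hmono : Monotone fun m => ∫⁻ x, expNeg (g x) * expQuot m (f x) ∂ν := fun _ _ hij =>
    lintegral_mono fun x => mul_le_mul_right (expQuot_mono_left (f x) hij) _
  calc ∫⁻ ω, expNeg (∫⁻ x, g x ∂(N ω)) * ∫⁻ x, f x ∂(N ω) ∂μ
      = ⨆ m, ∫⁻ ω, expNeg (∫⁻ x, g x ∂(N ω)) * expQuot m (∫⁻ x, f x ∂(N ω)) ∂μ :=
        lintegral_expNeg_mul_eq_iSup (hN.measurable_lintegral hg) (hN.measurable_lintegral hf)
    _ = expNeg (∫⁻ x, (1 - expNeg (g x)) ∂ν) *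
          ⨆ m, expQuot m (∫⁻ x, expNeg (g x) * expQuot m (f x) ∂ν) := by
        simp_rw [hN.lintegral_expNeg_mul_expQuot hf hg, ENNReal.mul_iSup]
    _ = expNeg (∫⁻ x, (1 - expNeg (g x)) ∂ν) * ∫⁻ x, expNeg (g x) * f x ∂ν := by
        rw [iSup_expQuot_of_monotone hmono, ← lintegral_expNeg_mul_eq_iSup hg hf]

end IsPoissonRandomMeasure

section LaplaceUniqueness

variable {ι : Type*} [Fintype ι]

/-- The bounded continuous functions `t ↦ e^{-⟨a, t⟩}` on the orthant. -/
def expNegHom : Multiplicative (ι → ℝ≥0) →* ((ι → ℝ≥0) →ᵇ ℝ) where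
  toFun a := BoundedContinuousFunction.ofNormedAddCommGroup
    (fun t => Real.exp (-((∑ i, a.toAdd i * t i : ℝ≥0) : ℝ))) (by fun_prop) 1 (fun t => by
      rw [Real.norm_eq_abs, abs_of_pos (Real.exp_pos _), Real.exp_le_one_iff]
      simp only [Left.neg_nonpos_iff, NNReal.zero_le_coe])
  map_one' := by ext t; simp
  map_mul' a b := by
    ext t
    simp [add_mul, Finset.sum_add_distrib, ← Real.exp_add]
    ring

lemma expNegHom_apply (a : Multiplicative (ι → ℝ≥0)) (t : ι → ℝ≥0) :
    expNegHom a t = Real.exp (-((∑ i, a.toAdd i * t i : ℝ≥0) : ℝ)) := rfl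

/-- The linear span of the functions `t ↦ e^{-⟨a, t⟩}`, an algebra. -/
def expNegAlgebra (ι : Type*) [Fintype ι] : StarSubalgebra ℝ ((ι → ℝ≥0) →ᵇ ℝ) where
  toSubalgebra := Algebra.adjoin ℝ (MonoidHom.mrange (expNegHom (ι := ι)) : Set _)
  star_mem' := fun {f} hf => by
    have : star f = f := by ext t; simp
    rwa [this]

lemma toReal_lintegral_expNeg (μ : Measure (ι → ℝ≥0)) (a : Multiplicative (ι → ℝ≥0)) :
    (∫⁻ t, expNeg (∑ i, (a.toAdd i : ℝ≥0∞) * t i) ∂μ).toReal = ∫ t, expNegHom a t ∂μ := by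
  rw [integral_eq_lintegral_of_nonneg_ae (f := expNegHom a)
    (ae_of_all _ fun t => (Real.exp_pos _).le) (expNegHom a).continuous.aestronglyMeasurable]
  congr 1
  refine lintegral_congr fun t => ?_
  rw [expNegHom_apply, ← expNeg_coe]
  push_cast
  rfl

lemma ext_of_lintegral_expNeg {μ ν : Measure (ι → ℝ≥0)} [IsFiniteMeasure μ]
    (h : ∀ a : ι → ℝ≥0, ∫⁻ t, expNeg (∑ i, (a i : ℝ≥0∞) * t i) ∂μ =
      ∫⁻ t, expNeg (∑ i, (a i : ℝ≥0∞) * t i) ∂ν) : μ = ν := by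
  classical
  have : IsFiniteMeasure ν := ⟨by
    have huniv : μ univ = ν univ := by simpa using h 0
    exact huniv ▸ measure_lt_top μ univ⟩
  refine ext_of_forall_mem_subalgebra_integral_eq_of_pseudoEMetric_complete_countable
    (𝕜 := ℝ) (A := expNegAlgebra ι) ?_ fun g hg => ?_
  · intro s t hst
    obtain ⟨i, hi⟩ := Function.ne_iff.1 hst
    refine ⟨expNegHom (Multiplicative.ofAdd (Pi.single i 1)), ⟨_, ⟨_,
      Algebra.subset_adjoin ⟨Multiplicative.ofAdd (Pi.single i 1), rfl⟩, rfl⟩, rfl⟩, ?_⟩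
    rw [expNegHom_apply, expNegHom_apply]
    simpa [Pi.single_apply] using hi
  · have hg' : g ∈ Submodule.span ℝ (MonoidHom.mrange (expNegHom (ι := ι)) : Set _) := by
      have h1 : g ∈ Subalgebra.toSubmodule
        (Algebra.adjoin ℝ (MonoidHom.mrange (expNegHom (ι := ι)) : Set _)) := hg
      rwa [Algebra.adjoin_eq_span, Submonoid.closure_eq] at h1
    clear hg
    induction hg' using Submodule.span_induction with
    | mem f hf =>
      obtain ⟨a, rfl⟩ := hf
      rw [← toReal_lintegral_expNeg, ← toReal_lintegral_expNeg, h]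
    | zero => simp
    | add f g _ _ hf hg =>
      simp only [BoundedContinuousFunction.coe_add, Pi.add_apply]
      rw [integral_add (f.integrable μ) (g.integrable μ),
        integral_add (f.integrable ν) (g.integrable ν), hf, hg]
    | smul r f _ hf =>
      simp only [BoundedContinuousFunction.coe_smul]
      rw [integral_smul, integral_smul, hf]

end LaplaceUniqueness

section Gamma

lemma lintegral_rpow_mul_exp_neg {p r : ℝ} (hp : 0 < p) (hr : 0 < r) :
    ∫⁻ x in Ioi (0 : ℝ), ENNReal.ofReal (x ^ (p - 1) * Real.exp (-(r * x))) =
      ENNReal.ofReal (Real.Gamma p / r ^ p) := by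
  have hint := Real.integral_rpow_mul_exp_neg_mul_Ioi hp hr
  have hpos : 0 < (1 / r) ^ p * Real.Gamma p :=
    mul_pos (by positivity) (Real.Gamma_pos_of_pos hp)
  rw [← ofReal_integral_eq_lintegral_ofReal
    (Integrable.of_integral_ne_zero (by rw [hint]; exact hpos.ne')), hint,
    Real.div_rpow zero_le_one hr.le, Real.one_rpow, one_div_mul_eq_div]
  filter_upwards [ae_restrict_mem measurableSet_Ioi] with x (hx : 0 < x)
  positivity

lemma expNeg_coe_mul_ofReal (b : ℝ≥0) {x : ℝ} (hx : 0 ≤ x) :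
    expNeg (b * ENNReal.ofReal x) = ENNReal.ofReal (Real.exp (-(b * x))) := by
  rw [← ENNReal.ofReal_coe_nnreal, ← ENNReal.ofReal_mul b.coe_nonneg,
    expNeg_ofReal (by positivity)]

lemma exp_neg_one_add_mul (b x : ℝ) :
    Real.exp (-((1 + b) * x)) = Real.exp (-x) * Real.exp (-(b * x)) := by
  rw [← Real.exp_add]
  congr 1
  ring

/-- The Gamma law with shape `α` and rate `1`, carried over to `[0, ∞)` because the masses of
buckets live there. -/
def gammaLaw (α : ℝ) : Measure ℝ≥0 := (gammaMeasure α 1).map Real.toNNReal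

lemma lintegral_gammaLaw (α : ℝ) {f : ℝ≥0 → ℝ≥0∞} (hf : Measurable f) :
    ∫⁻ t, f t ∂gammaLaw α = ∫⁻ x in Ioi (0 : ℝ),
      ENNReal.ofReal (1 / Real.Gamma α * x ^ (α - 1) * Real.exp (-x)) * f x.toNNReal := by
  have hpdf : Measurable (gammaPDF α 1) := (measurable_gammaPDFReal α 1).ennreal_ofReal
  rw [gammaLaw, lintegral_map hf (by fun_prop), gammaMeasure,
    lintegral_withDensity_eq_lintegral_mul _ hpdf (by fun_prop),
    ← lintegral_add_compl _ (measurableSet_Ici (a := (0 : ℝ))), compl_Ici,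
    setLIntegral_congr_fun (g := fun _ => 0) measurableSet_Iio fun x hx => by
      simp only [Pi.mul_apply, gammaPDF_of_neg hx, zero_mul],
    lintegral_zero, add_zero, setLIntegral_congr Ioi_ae_eq_Ici.symm]
  refine setLIntegral_congr_fun measurableSet_Ioi fun x (hx : 0 < x) => ?_
  simp only [Pi.mul_apply, gammaPDF_of_nonneg hx.le, Real.one_rpow, one_mul]

lemma lintegral_pow_mul_expNeg_gammaLaw {α : ℝ} (hα : 0 < α) (k : ℕ) (b : ℝ≥0) :
    ∫⁻ t : ℝ≥0, (t : ℝ≥0∞) ^ k * expNeg (b * t) ∂gammaLaw α =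
      ENNReal.ofReal (Real.Gamma (α + k) / Real.Gamma α / (1 + b) ^ k) *
        ENNReal.ofReal ((1 + b) ^ α)⁻¹ := by
  have := Real.Gamma_pos_of_pos hα
  have : 0 < Real.Gamma (α + k) := Real.Gamma_pos_of_pos (by positivity)
  have hintegrand : ∀ x ∈ Ioi (0 : ℝ),
      ENNReal.ofReal (1 / Real.Gamma α * x ^ (α - 1) * Real.exp (-x)) *
        ((x.toNNReal : ℝ≥0∞) ^ k * expNeg (b * x.toNNReal)) =
      ENNReal.ofReal (1 / Real.Gamma α) *
        ENNReal.ofReal (x ^ (α + k - 1) * Real.exp (-((1 + b) * x))) := fun x (hx : 0 < x) => by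
    change _ * (ENNReal.ofReal x ^ k * expNeg (b * ENNReal.ofReal x)) = _
    rw [expNeg_coe_mul_ofReal b hx.le, ← ENNReal.ofReal_pow hx.le,
      ← ENNReal.ofReal_mul (by positivity), ← ENNReal.ofReal_mul (by positivity),
      ← ENNReal.ofReal_mul (by positivity), add_sub_right_comm, Real.rpow_add hx,
      Real.rpow_natCast, exp_neg_one_add_mul]
    congr 1
    ring
  rw [lintegral_gammaLaw α (by fun_prop), setLIntegral_congr_fun measurableSet_Ioi hintegrand,
    lintegral_const_mul _ (by fun_prop), lintegral_rpow_mul_exp_neg (by positivity) (by positivity),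
    ← ENNReal.ofReal_mul (by positivity), ← ENNReal.ofReal_mul (by positivity),
    Real.rpow_add (by positivity), Real.rpow_natCast]
  congr 1
  field_simp

lemma isProbabilityMeasure_gammaLaw {α : ℝ} (hα : 0 < α) : IsProbabilityMeasure (gammaLaw α) :=
  have := isProbabilityMeasure_gammaMeasure hα one_pos
  Measure.isProbabilityMeasure_map (by fun_prop)

lemma gammaLaw_ae_ne_zero (α : ℝ) : ∀ᵐ t ∂gammaLaw α, t ≠ 0 := by
  rw [ae_iff, ← lintegral_indicator_one (by simp),
    lintegral_gammaLaw α (measurable_one.indicator (by simp))]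
  refine setLIntegral_eq_zero measurableSet_Ioi fun x (hx : 0 < x) => ?_
  simp [hx]

lemma ofReal_one_sub_exp_neg_mul_exp_neg_div (a : ℝ≥0) {x : ℝ} (hx : 0 < x) :
    ENNReal.ofReal (Real.exp (-x) / x * (1 - Real.exp (-(a * x)))) =
      ∫⁻ u in Ioc (0 : ℝ) a, ENNReal.ofReal (Real.exp (-((1 + u) * x))) := by
  have hderiv : ∀ u ∈ uIcc (0 : ℝ) a, HasDerivAt (fun u : ℝ => -Real.exp (-((1 + u) * x)) / x)
      (Real.exp (-((1 + u) * x))) u := fun u _ => by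
    have := ((((hasDerivAt_id u).const_add 1).mul_const x).neg.exp.neg).div_const x
    refine this.congr_deriv ?_
    simp only [id_eq, Pi.neg_apply, one_mul, mul_neg, neg_neg]
    field_simp
  rw [← ofReal_integral_eq_lintegral_ofReal
      ((Continuous.integrableOn_Icc (by fun_prop)).mono_set Ioc_subset_Icc_self)
      (ae_of_all _ fun u => (Real.exp_pos _).le),
    ← intervalIntegral.integral_of_le a.coe_nonneg,
    intervalIntegral.integral_eq_sub_of_hasDerivAt hderiv
      (Continuous.intervalIntegrable (by fun_prop) _ _)]
  simp_rw [exp_neg_one_add_mul]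
  simp only [zero_mul, neg_zero, Real.exp_zero]
  congr 1
  ring

lemma lintegral_Ioc_inv_one_add (a : ℝ≥0) :
    ∫⁻ u in Ioc (0 : ℝ) a, ENNReal.ofReal (1 + u)⁻¹ = ENNReal.ofReal (Real.log (1 + a)) := by
  have hpos : ∀ u ∈ Ioc (0 : ℝ) a, 0 ≤ (1 + u)⁻¹ := fun u hu =>
    inv_nonneg.2 (by linarith [hu.1])
  have hcont : ContinuousOn (fun u : ℝ => (1 + u)⁻¹) (Icc 0 a) :=
    ContinuousOn.inv₀ (by fun_prop) fun u hu => by linarith [hu.1]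
  rw [← ofReal_integral_eq_lintegral_ofReal (hcont.integrableOn_Icc.mono_set Ioc_subset_Icc_self)
      ((ae_restrict_mem measurableSet_Ioc).mono hpos),
    ← intervalIntegral.integral_of_le a.coe_nonneg,
    intervalIntegral.integral_comp_add_left (fun x : ℝ => x⁻¹) 1,
    integral_inv_of_pos (by norm_num) (by positivity)]
  simp

lemma lintegral_frullani (a : ℝ≥0) :
    ∫⁻ x in Ioi (0 : ℝ), ENNReal.ofReal (Real.exp (-x) / x) * (1 - expNeg (a * ENNReal.ofReal x)) =
      ENNReal.ofReal (Real.log (1 + a)) :=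
  calc ∫⁻ x in Ioi (0 : ℝ),
        ENNReal.ofReal (Real.exp (-x) / x) * (1 - expNeg (a * ENNReal.ofReal x))
      = ∫⁻ x in Ioi (0 : ℝ), ∫⁻ u in Ioc (0 : ℝ) a, ENNReal.ofReal (Real.exp (-((1 + u) * x))) :=
        setLIntegral_congr_fun measurableSet_Ioi fun x (hx : 0 < x) => by
          rw [expNeg_coe_mul_ofReal a hx.le, ← ENNReal.ofReal_one,
            ← ENNReal.ofReal_sub _ (Real.exp_nonneg _), ← ENNReal.ofReal_mul (by positivity),
            ofReal_one_sub_exp_neg_mul_exp_neg_div a hx]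
    _ = ∫⁻ u in Ioc (0 : ℝ) a, ∫⁻ x in Ioi (0 : ℝ), ENNReal.ofReal (Real.exp (-((1 + u) * x))) :=
        lintegral_lintegral_swap (by fun_prop)
    _ = ∫⁻ u in Ioc (0 : ℝ) a, ENNReal.ofReal (1 + u)⁻¹ :=
        setLIntegral_congr_fun measurableSet_Ioc fun u hu => by
          simpa using lintegral_rpow_mul_exp_neg one_pos (show 0 < 1 + u by linarith [hu.1])
    _ = ENNReal.ofReal (Real.log (1 + a)) := lintegral_Ioc_inv_one_add a

end Gamma

section Masses

lemma lintegral_prod_pi {ι : Type*} [Fintype ι] {E : ι → Type*} [∀ i, MeasurableSpace (E i)]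
    (ρ : ∀ i, Measure (E i)) [∀ i, IsProbabilityMeasure (ρ i)] {F : ∀ i, E i → ℝ≥0∞}
    (hF : ∀ i, Measurable (F i)) :
    ∫⁻ t, ∏ i, F i (t i) ∂(Measure.pi ρ) = ∏ i, ∫⁻ x, F i x ∂(ρ i) := by
  refine (lintegral_prod_eq_prod_lintegral_of_indepFun Finset.univ
    (fun i (t : ∀ i, E i) => F i (t i)) (iIndepFun_pi fun i => (hF i).aemeasurable)
    fun i => (hF i).comp (measurable_pi_apply i)).trans ?_
  refine Finset.prod_congr rfl fun i _ => ?_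
  rw [← lintegral_map (hF i) (measurable_pi_apply i), (measurePreserving_eval ρ i).map_eq]

lemma lintegral_pow_mul_expNeg_pi_gammaLaw {ι : Type*} [Fintype ι] {α : ι → ℝ}
    (hα : ∀ i, 0 < α i) (j : ι) (k : ℕ) (a : ι → ℝ≥0) :
    ∫⁻ t, (t j : ℝ≥0∞) ^ k * expNeg (∑ i, (a i : ℝ≥0∞) * t i)
        ∂Measure.pi (fun i => gammaLaw (α i)) =
      ENNReal.ofReal (Real.Gamma (α j + k) / Real.Gamma (α j) / (1 + a j) ^ k) *
        ∏ i, ENNReal.ofReal ((1 + a i) ^ α i)⁻¹ := by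
  classical
  have := fun i => isProbabilityMeasure_gammaLaw (hα i)
  let e : ι → ℕ := Pi.single j k
  have hej : e j = k := Pi.single_eq_same (M := fun _ => ℕ) j k
  have hei : ∀ i ≠ j, e i = 0 := fun i hi => Pi.single_eq_of_ne (M := fun _ => ℕ) hi k
  have hfactor : ∀ t : ι → ℝ≥0, (t j : ℝ≥0∞) ^ k * expNeg (∑ i, (a i : ℝ≥0∞) * t i) =
      ∏ i, (t i : ℝ≥0∞) ^ e i * expNeg (a i * t i) := fun t => by
    rw [Finset.prod_mul_distrib, expNeg_sum, Fintype.prod_eq_single (f := fun i => _ ^ e i) j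
      fun i hi => by rw [hei i hi, pow_zero], hej]
  simp_rw [hfactor]
  rw [lintegral_prod_pi _ (F := fun i (x : ℝ≥0) => (x : ℝ≥0∞) ^ e i * expNeg (a i * x))
    fun i => by fun_prop]
  simp_rw [lintegral_pow_mul_expNeg_gammaLaw (hα _)]
  rw [Finset.prod_mul_distrib, Fintype.prod_eq_single j fun i hi => by
    simp [hei i hi, (Real.Gamma_pos_of_pos (hα i)).ne'], hej]

lemma lintegral_expNeg_pi_gammaLaw {ι : Type*} [Fintype ι] {α : ι → ℝ} (hα : ∀ i, 0 < α i)
    (a : ι → ℝ≥0) :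
    ∫⁻ t, expNeg (∑ i, (a i : ℝ≥0∞) * t i) ∂Measure.pi (fun i => gammaLaw (α i)) =
      ∏ i, ENNReal.ofReal ((1 + a i) ^ α i)⁻¹ := by
  cases isEmpty_or_nonempty ι
  · simp
  · obtain ⟨j⟩ := ‹Nonempty ι›
    simpa [(Real.Gamma_pos_of_pos (hα j)).ne'] using
      lintegral_pow_mul_expNeg_pi_gammaLaw hα j 0 a

variable {S : Type*} [MeasurableSpace S] {J : ℕ}

/-- The concentration parameter `θ G₀(h⁻¹{j})` of the Dirichlet process inside the bucket `j`; it
is also the shape of the Gamma law of the mass of that bucket. -/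
def bucketShape (θ : ℝ) (G₀ : Measure S) (h : S → Fin J) (j : Fin J) : ℝ :=
  θ * bucketProb h G₀ j

lemma lintegral_gammaIntensity (θ : ℝ) (G₀ : Measure S) [IsFiniteMeasure G₀] {h : S → Fin J}
    (hh : Measurable h) {F : ℝ → Fin J → ℝ≥0∞} (hF : ∀ j, Measurable fun x => F x j) :
    ∫⁻ p, F p.1 (h p.2) ∂(gammaIntensity θ G₀) = ∑ j, ENNReal.ofReal (bucketShape θ G₀ h j) *
      ∫⁻ x in Ioi (0 : ℝ), ENNReal.ofReal (Real.exp (-x) / x) * F x j := by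
  have hF' : Measurable fun p : ℝ × S => F p.1 (h p.2) :=
    (measurable_from_prod_countable_left hF : Measurable (Function.uncurry F)).comp
      (measurable_fst.prodMk (hh.comp measurable_snd))
  have hinner : ∀ x, ∫⁻ s, F x (h s) ∂G₀ = ∑ j, F x j * G₀ (h ⁻¹' {j}) := fun x => by
    rw [← lintegral_map (f := F x) .of_discrete hh, lintegral_fintype]
    exact Finset.sum_congr rfl fun j _ => by
      rw [Measure.map_apply hh (measurableSet_singleton j)]
  rw [gammaIntensity, lintegral_smul_measure, lintegral_prod _ hF'.aemeasurable]
  simp_rw [hinner]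
  rw [lintegral_finsetSum _ fun j _ => (hF j).mul_const _, smul_eq_mul, Finset.mul_sum]
  refine Finset.sum_congr rfl fun j _ => ?_
  rw [lintegral_mul_const _ (hF j), lintegral_withDensity_eq_lintegral_mul _ (by fun_prop) (hF j),
    bucketShape, bucketProb, ENNReal.ofReal_mul' measureReal_nonneg, ofReal_measureReal, mul_assoc,
    mul_comm (G₀ _)]
  rfl

/-- The function `(x, s) ↦ x ^ r 1[h(s) = j]`, whose integrals against the point measure of the
jumps are the power sums of the jumps in the bucket `j`. -/
def jumpPower (h : S → Fin J) (j : Fin J) (r : ℕ) (p : ℝ × S) : ℝ≥0∞ :=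
  if h p.2 = j then ENNReal.ofReal p.1 ^ r else 0

@[fun_prop]
lemma measurable_jumpPower {h : S → Fin J} (hh : Measurable h) (j : Fin J) (r : ℕ) :
    Measurable (jumpPower h j r) :=
  .ite (hh.comp measurable_snd (measurableSet_singleton j)) (by fun_prop) measurable_const

lemma sum_mul_jumpPower {S : Type*} (h : S → Fin J) (a : Fin J → ℝ≥0∞) (p : ℝ × S) :
    ∑ j, a j * jumpPower h j 1 p = a (h p.2) * ENNReal.ofReal p.1 := by
  simp [jumpPower]

section Intensity

variable {G₀ : Measure S} [IsFiniteMeasure G₀] {θ : ℝ} {h : S → Fin J}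

lemma expNeg_lintegral_gammaIntensity (hh : Measurable h) (hα : ∀ j, 0 ≤ bucketShape θ G₀ h j)
    (a : Fin J → ℝ≥0) :
    expNeg (∫⁻ p, (1 - expNeg (∑ j, (a j : ℝ≥0∞) * jumpPower h j 1 p)) ∂(gammaIntensity θ G₀)) =
      ∏ j, ENNReal.ofReal ((1 + a j) ^ bucketShape θ G₀ h j)⁻¹ := by
  simp_rw [sum_mul_jumpPower]
  rw [lintegral_gammaIntensity θ G₀ hh
    (F := fun x j => 1 - expNeg ((a j : ℝ≥0∞) * ENNReal.ofReal x)) fun j => by fun_prop]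
  simp_rw [lintegral_frullani]
  rw [expNeg_sum]
  refine Finset.prod_congr rfl fun j _ => ?_
  have hlog : 0 ≤ Real.log (1 + a j) := Real.log_nonneg (by simp)
  rw [← ENNReal.ofReal_mul (hα j), expNeg_ofReal (mul_nonneg (hα j) hlog),
    Real.rpow_def_of_pos (by positivity), ← Real.exp_neg, mul_comm]

lemma lintegral_expNeg_mul_jumpPower (hh : Measurable h) (a : Fin J → ℝ≥0) (j : Fin J) (r : ℕ) :
    ∫⁻ p, expNeg (∑ i, (a i : ℝ≥0∞) * jumpPower h i 1 p) * jumpPower h j (r + 1) p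
        ∂(gammaIntensity θ G₀) =
      ENNReal.ofReal (bucketShape θ G₀ h j) *
        ENNReal.ofReal (r.factorial / (1 + a j) ^ (r + 1)) := by
  have hintegrand : ∀ x ∈ Ioi (0 : ℝ), ENNReal.ofReal (Real.exp (-x) / x) *
      (expNeg (a j * ENNReal.ofReal x) * ENNReal.ofReal x ^ (r + 1)) =
      ENNReal.ofReal (x ^ (((r + 1 : ℕ) : ℝ) - 1) * Real.exp (-((1 + a j) * x))) :=
    fun x (hx : 0 < x) => by
      rw [expNeg_coe_mul_ofReal _ hx.le, ← ENNReal.ofReal_pow hx.le,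
        ← ENNReal.ofReal_mul (by positivity), ← ENNReal.ofReal_mul (by positivity),
        exp_neg_one_add_mul, Nat.cast_succ, add_sub_cancel_right, Real.rpow_natCast]
      congr 1
      field_simp
      ring
  simp_rw [sum_mul_jumpPower, jumpPower]
  rw [lintegral_gammaIntensity θ G₀ hh (F := fun x i =>
    expNeg ((a i : ℝ≥0∞) * ENNReal.ofReal x) * if i = j then ENNReal.ofReal x ^ (r + 1) else 0)
    fun i => by split_ifs <;> fun_prop]
  rw [Fintype.sum_eq_single j fun i hi => by simp [hi]]
  simp only [if_true]
  rw [setLIntegral_congr_fun measurableSet_Ioi hintegrand,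
    lintegral_rpow_mul_exp_neg (by positivity) (by positivity), Nat.cast_succ,
    Real.Gamma_nat_eq_factorial, ← Nat.cast_succ, Real.rpow_natCast]

end Intensity

variable {Ω : Type*} [MeasurableSpace Ω] {μ : Measure Ω} {N : Ω → Measure (ℝ × S)}
  {G₀ : Measure S} {θ : ℝ} {h : S → Fin J}

/-- The masses `μ̃(h⁻¹{j})` of the buckets, made finite on a null set in order to live in
`[0, ∞)`. -/
def bucketMass (N : Ω → Measure (ℝ × S)) (h : S → Fin J) (ω : Ω) (j : Fin J) : ℝ≥0 :=
  (∫⁻ p, jumpPower h j 1 p ∂(N ω)).toNNReal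

lemma measurable_bucketMass (hN : IsPoissonRandomMeasure μ N (gammaIntensity θ G₀))
    (hh : Measurable h) : Measurable (bucketMass N h) :=
  measurable_pi_lambda _ fun j =>
    (hN.measurable_lintegral (measurable_jumpPower hh j 1)).ennreal_toNNReal

variable [IsProbabilityMeasure μ] [IsFiniteMeasure G₀]

lemma lintegral_expNeg_mul_lintegral_jumpPower
    (hN : IsPoissonRandomMeasure μ N (gammaIntensity θ G₀)) (hh : Measurable h)
    (hα : ∀ j, 0 ≤ bucketShape θ G₀ h j) (a : Fin J → ℝ≥0) (j : Fin J) (r : ℕ) :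
    ∫⁻ ω, expNeg (∫⁻ p, ∑ i, (a i : ℝ≥0∞) * jumpPower h i 1 p ∂(N ω)) *
        ∫⁻ p, jumpPower h j (r + 1) p ∂(N ω) ∂μ =
      ENNReal.ofReal (bucketShape θ G₀ h j) *
        ENNReal.ofReal (r.factorial / (1 + a j) ^ (r + 1)) *
          ∏ i, ENNReal.ofReal ((1 + a i) ^ bucketShape θ G₀ h i)⁻¹ := by
  rw [hN.lintegral_expNeg_mul_lintegral (by fun_prop) (by fun_prop),
    expNeg_lintegral_gammaIntensity hh hα, lintegral_expNeg_mul_jumpPower hh, mul_comm]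

lemma lintegral_lintegral_jumpPower_lt_top
    (hN : IsPoissonRandomMeasure μ N (gammaIntensity θ G₀)) (hh : Measurable h)
    (hα : ∀ j, 0 ≤ bucketShape θ G₀ h j) (j : Fin J) (r : ℕ) :
    ∫⁻ ω, ∫⁻ p, jumpPower h j (r + 1) p ∂(N ω) ∂μ < ∞ := by
  have hzero := lintegral_expNeg_mul_lintegral_jumpPower hN hh hα 0 j r
  simp only [Pi.zero_apply, ENNReal.coe_zero, zero_mul, Finset.sum_const_zero, lintegral_zero,
    expNeg_zero, one_mul] at hzero
  rw [hzero]
  exact ENNReal.mul_lt_top (ENNReal.mul_lt_top ENNReal.ofReal_lt_top ENNReal.ofReal_lt_top)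
    (ENNReal.prod_lt_top fun _ _ => ENNReal.ofReal_lt_top)

lemma ae_coe_bucketMass (hN : IsPoissonRandomMeasure μ N (gammaIntensity θ G₀))
    (hh : Measurable h) (hα : ∀ j, 0 ≤ bucketShape θ G₀ h j) :
    ∀ᵐ ω ∂μ, ∀ j, (bucketMass N h ω j : ℝ≥0∞) = ∫⁻ p, jumpPower h j 1 p ∂(N ω) :=
  ae_all_iff.2 fun j => by
    filter_upwards [ae_lt_top (hN.measurable_lintegral (measurable_jumpPower hh j 1))
      (lintegral_lintegral_jumpPower_lt_top hN hh hα j 0).ne] with ω hω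
    exact ENNReal.coe_toNNReal hω.ne

lemma ae_sum_mul_bucketMass (hN : IsPoissonRandomMeasure μ N (gammaIntensity θ G₀))
    (hh : Measurable h) (hα : ∀ j, 0 ≤ bucketShape θ G₀ h j) (a : Fin J → ℝ≥0) :
    ∀ᵐ ω ∂μ, ∑ i, (a i : ℝ≥0∞) * bucketMass N h ω i =
      ∫⁻ p, ∑ i, (a i : ℝ≥0∞) * jumpPower h i 1 p ∂(N ω) := by
  filter_upwards [ae_coe_bucketMass hN hh hα] with ω hω
  rw [lintegral_finsetSum _ fun i _ => by fun_prop]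
  exact Finset.sum_congr rfl fun i _ => by rw [hω, lintegral_const_mul _ (by fun_prop)]

lemma map_bucketMass (hN : IsPoissonRandomMeasure μ N (gammaIntensity θ G₀))
    (hh : Measurable h) (hα : ∀ j, 0 < bucketShape θ G₀ h j) :
    μ.map (bucketMass N h) = Measure.pi fun j => gammaLaw (bucketShape θ G₀ h j) := by
  have hT := measurable_bucketMass hN hh
  refine ext_of_lintegral_expNeg fun a => ?_
  calc ∫⁻ t, expNeg (∑ i, (a i : ℝ≥0∞) * t i) ∂(μ.map (bucketMass N h))
      = ∫⁻ ω, expNeg (∑ i, (a i : ℝ≥0∞) * bucketMass N h ω i) ∂μ :=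
        lintegral_map (by fun_prop) hT
    _ = ∫⁻ ω, expNeg (∫⁻ p, ∑ i, (a i : ℝ≥0∞) * jumpPower h i 1 p ∂(N ω)) ∂μ :=
        lintegral_congr_ae <|
          (ae_sum_mul_bucketMass hN hh (fun j => (hα j).le) a).mono fun ω hω => congrArg expNeg hω
    _ = ∏ i, ENNReal.ofReal ((1 + a i) ^ bucketShape θ G₀ h i)⁻¹ := by
        rw [hN.lintegral_expNeg (by fun_prop),
          expNeg_lintegral_gammaIntensity hh fun j => (hα j).le]
    _ = _ := (lintegral_expNeg_pi_gammaLaw hα a).symm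

lemma ae_bucketMass_ne_zero (hN : IsPoissonRandomMeasure μ N (gammaIntensity θ G₀))
    (hh : Measurable h) (hα : ∀ j, 0 < bucketShape θ G₀ h j) :
    ∀ᵐ ω ∂μ, ∀ j, bucketMass N h ω j ≠ 0 := by
  have := fun j => isProbabilityMeasure_gammaLaw (hα j)
  refine ae_of_ae_map (p := fun t => ∀ j, t j ≠ 0) (measurable_bucketMass hN hh).aemeasurable ?_
  rw [map_bucketMass hN hh hα]
  exact ae_all_iff.2 fun j => (measurePreserving_eval (fun j => gammaLaw (bucketShape θ G₀ h j))
    j).quasiMeasurePreserving.ae (gammaLaw_ae_ne_zero _)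

/-- The moment `E[∑ₖ pₖ ^ (r + 1)] = α B(r + 1, α)` of the weights `pₖ` of a Dirichlet process with
concentration parameter `α`. -/
def weightMoment (α : ℝ) (r : ℕ) : ℝ :=
  α * beta (r + 1) α

lemma weightMoment_nonneg {α : ℝ} (hα : 0 < α) (r : ℕ) : 0 ≤ weightMoment α r :=
  mul_nonneg hα.le (beta_pos (by positivity) hα).le

lemma weightMoment_mul_Gamma_div_Gamma {α : ℝ} (hα : 0 < α) (r : ℕ) :
    weightMoment α r * (Real.Gamma (α + (r + 1 : ℕ)) / Real.Gamma α) = α * r.factorial := by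
  have := Real.Gamma_pos_of_pos hα
  have : 0 < Real.Gamma (α + (r + 1 : ℕ)) := Real.Gamma_pos_of_pos (by positivity)
  rw [weightMoment, beta, ← Nat.cast_succ, add_comm _ α, Nat.cast_succ r,
    Real.Gamma_nat_eq_factorial, ← Nat.cast_succ]
  field_simp

/-- This encodes that a size-biased jump carries a `Beta(1, α)` share of its bucket, independent of
the bucket masses. -/
lemma map_withDensity_jumpPower (hN : IsPoissonRandomMeasure μ N (gammaIntensity θ G₀))
    (hh : Measurable h) (hα : ∀ j, 0 < bucketShape θ G₀ h j) (j : Fin J) (r : ℕ) :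
    (μ.withDensity fun ω => ∫⁻ p, jumpPower h j (r + 1) p ∂(N ω)).map (bucketMass N h) =
      (μ.map (bucketMass N h)).withDensity
        fun t => ENNReal.ofReal (weightMoment (bucketShape θ G₀ h j) r) * (t j) ^ (r + 1) := by
  have hT := measurable_bucketMass hN hh
  have hα' := fun j => (hα j).le
  have hR := hN.measurable_lintegral (measurable_jumpPower hh j (r + 1))
  have := isFiniteMeasure_withDensity (lintegral_lintegral_jumpPower_lt_top hN hh hα' j r).ne
  refine ext_of_lintegral_expNeg fun a => ?_
  rw [lintegral_map (by fun_prop) hT, lintegral_withDensity_eq_lintegral_mul _ hR (by fun_prop),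
    map_bucketMass hN hh hα, lintegral_withDensity_eq_lintegral_mul _ (by fun_prop) (by fun_prop)]
  calc ∫⁻ ω, (∫⁻ p, jumpPower h j (r + 1) p ∂(N ω)) *
        expNeg (∑ i, (a i : ℝ≥0∞) * bucketMass N h ω i) ∂μ
      = ∫⁻ ω, expNeg (∫⁻ p, ∑ i, (a i : ℝ≥0∞) * jumpPower h i 1 p ∂(N ω)) *
        ∫⁻ p, jumpPower h j (r + 1) p ∂(N ω) ∂μ :=
        lintegral_congr_ae <| (ae_sum_mul_bucketMass hN hh hα' a).mono fun ω hω => by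
          simp only [hω, mul_comm]
    _ = ENNReal.ofReal (weightMoment (bucketShape θ G₀ h j) r) *
          ∫⁻ t, (t j : ℝ≥0∞) ^ (r + 1) * expNeg (∑ i, (a i : ℝ≥0∞) * t i)
            ∂Measure.pi (fun i => gammaLaw (bucketShape θ G₀ h i)) := by
        rw [lintegral_expNeg_mul_lintegral_jumpPower hN hh hα',
          lintegral_pow_mul_expNeg_pi_gammaLaw hα, ← mul_assoc,
          ← ENNReal.ofReal_mul (weightMoment_nonneg (hα j) r), ← mul_div_assoc,
          weightMoment_mul_Gamma_div_Gamma (hα j), ← ENNReal.ofReal_mul (hα' j), mul_div_assoc]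
    _ = _ := by
        rw [← lintegral_const_mul _ (by fun_prop)]
        simp only [Pi.mul_apply, mul_assoc]

lemma setLIntegral_jumpPower_div_bucketMass
    (hN : IsPoissonRandomMeasure μ N (gammaIntensity θ G₀)) (hh : Measurable h)
    (hα : ∀ j, 0 < bucketShape θ G₀ h j) (j : Fin J) (r : ℕ) {A : Set (Fin J → ℝ≥0)}
    (hA : MeasurableSet A) :
    ∫⁻ ω in bucketMass N h ⁻¹' A,
        (∫⁻ p, jumpPower h j (r + 1) p ∂(N ω)) / (bucketMass N h ω j) ^ (r + 1) ∂μ =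
      ENNReal.ofReal (weightMoment (bucketShape θ G₀ h j) r) * μ (bucketMass N h ⁻¹' A) := by
  have hT := measurable_bucketMass hN hh
  have hR := hN.measurable_lintegral (measurable_jumpPower hh j (r + 1))
  have hinv : Measurable fun t : Fin J → ℝ≥0 => ((t j : ℝ≥0∞) ^ (r + 1))⁻¹ := by fun_prop
  have hne : ∀ᵐ t ∂μ.map (bucketMass N h), t j ≠ 0 :=
    (ae_map_iff hT.aemeasurable (by measurability)).2 <|
      (ae_bucketMass_ne_zero hN hh hα).mono fun ω hω => hω j
  calc ∫⁻ ω in bucketMass N h ⁻¹' A,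
        (∫⁻ p, jumpPower h j (r + 1) p ∂(N ω)) / (bucketMass N h ω j) ^ (r + 1) ∂μ
      = ∫⁻ ω in bucketMass N h ⁻¹' A, ((bucketMass N h ω j : ℝ≥0∞) ^ (r + 1))⁻¹
          ∂μ.withDensity fun ω => ∫⁻ p, jumpPower h j (r + 1) p ∂(N ω) :=
        (setLIntegral_withDensity_eq_setLIntegral_mul _ hR (hinv.comp hT) (hT hA)).symm
    _ = ∫⁻ t in A, ((t j : ℝ≥0∞) ^ (r + 1))⁻¹ ∂(μ.map (bucketMass N h)).withDensity
          fun t => ENNReal.ofReal (weightMoment (bucketShape θ G₀ h j) r) * (t j) ^ (r + 1) := by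
        rw [← setLIntegral_map hA hinv hT, map_withDensity_jumpPower hN hh hα]
    _ = ∫⁻ _ in A, ENNReal.ofReal (weightMoment (bucketShape θ G₀ h j) r)
          ∂(μ.map (bucketMass N h)) := by
        rw [setLIntegral_withDensity_eq_setLIntegral_mul _ (by fun_prop) hinv hA]
        refine lintegral_congr_ae <| ae_restrict_of_ae <| hne.mono fun t ht => ?_
        simp only [Pi.mul_apply]
        rw [mul_assoc, ENNReal.mul_inv_cancel (pow_ne_zero _ (ENNReal.coe_ne_zero.2 ht))
          (ENNReal.pow_ne_top ENNReal.coe_ne_top), mul_one]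
    _ = _ := by rw [setLIntegral_const, Measure.map_apply hT hA]

end Masses

section DistinctLocations

variable {S : Type*} [MeasurableSpace S]

lemma sum_measure_preimage_singleton_sq {V : Type*} [Fintype V] [MeasurableSpace V]
    [MeasurableSingletonClass V] (ρ : Measure S) [SFinite ρ] {X : S → V} (hX : Measurable X) :
    ∑ v, ρ (X ⁻¹' {v}) ^ 2 = (ρ.prod ρ) {z | X z.1 = X z.2} := by
  have hm : MeasurableSet {z : S × S | X z.1 = X z.2} :=
    measurableSet_eq_fun (hX.comp measurable_fst) (hX.comp measurable_snd)
  calc ∑ v, ρ (X ⁻¹' {v}) ^ 2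
      = ∫⁻ v, ρ (X ⁻¹' {v}) ∂ρ.map X := by
        simp_rw [lintegral_fintype, Measure.map_apply hX (measurableSet_singleton _), sq]
    _ = ∫⁻ s, ρ (X ⁻¹' {X s}) ∂ρ := lintegral_map (measurable_of_finite _) hX
    _ = ∫⁻ s, ρ (Prod.mk s ⁻¹' {z | X z.1 = X z.2}) ∂ρ :=
        lintegral_congr fun s => congrArg ρ (Set.ext fun t => eq_comm)
    _ = (ρ.prod ρ) {z | X z.1 = X z.2} := (Measure.prod_apply hm).symm

lemma measurableEq_of_countablySeparated [MeasurableSpace.CountablySeparated S] :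
    MeasurableEq S := by
  obtain ⟨f, hf, hinj⟩ :=
    MeasurableSpace.measurable_injection_nat_bool_of_countablySeparated S
  have hdiag : diagonal S = {z | f z.1 = f z.2} := Set.ext fun z => hinj.eq_iff.symm
  exact ⟨hdiag ▸ measurableSet_eq_fun (hf.comp measurable_fst) (hf.comp measurable_snd)⟩

lemma tendsto_sum_measure_bits_sq [MeasurableEq S] (ρ : Measure S) [IsFiniteMeasure ρ]
    [NullSingletonClass ρ] {f : S → ℕ → Bool} (hf : Measurable f) (hinj : Function.Injective f) :
    Tendsto (fun m => ∑ v, ρ ((fun s (i : Fin m) => f s i) ⁻¹' {v}) ^ 2) atTop (𝓝 0) := by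
  let D : ℕ → Set (S × S) :=
    fun m => {z | (fun i : Fin m => f z.1 i) = fun i : Fin m => f z.2 i}
  have hbits : ∀ m, Measurable fun s (i : Fin m) => f s i := fun m => by fun_prop
  have hD : ∀ m, MeasurableSet (D m) := fun m =>
    measurableSet_eq_fun ((hbits m).comp measurable_fst) ((hbits m).comp measurable_snd)
  have hanti : Antitone D := fun m m' hm z hz => funext fun i => congrFun hz (Fin.castLE hm i)
  have hinter : ⋂ m, D m = diagonal S := by
    ext z
    refine mem_iInter.trans ⟨fun hz => hinj (funext fun i => ?_), fun hz m => ?_⟩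
    · exact congrFun (hz (i + 1)) (Fin.last i)
    · exact funext fun i => congrArg (f · i) hz
  have hdiag : (ρ.prod ρ) (diagonal S) = 0 :=
    (Measure.measure_prod_null measurableSet_diagonal).2 <| ae_of_all _ fun s =>
      (congrArg ρ (Set.ext fun t => eq_comm)).trans (measure_singleton s)
  simp_rw [fun m => sum_measure_preimage_singleton_sq ρ (hbits m)]
  rw [← hdiag, ← hinter]
  exact tendsto_measure_iInter_atTop (fun m => (hD m).nullMeasurableSet) hanti
    ⟨0, measure_ne_top _ _⟩

lemma two_le_pointMeasure {p : ℕ → ℝ × S} {A : Set (ℝ × S)} (hA : MeasurableSet A) {k l : ℕ}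
    (hkl : k ≠ l) (hk : p k ∈ A) (hl : p l ∈ A) : 2 ≤ pointMeasure p A := by
  rw [pointMeasure, Measure.sum_apply _ hA]
  refine le_trans ?_ (ENNReal.sum_le_tsum {k, l})
  rw [Finset.sum_pair hkl, Measure.dirac_apply_of_mem hk, Measure.dirac_apply_of_mem hl,
    one_add_one_eq_two]

lemma exists_gammaIntensity_Ioi_prod (θ : ℝ) (G₀ : Measure S) [SFinite G₀] {ε : ℝ} (hε : 0 < ε) :
    ∃ K : ℝ≥0, ∀ C : Set S, gammaIntensity θ G₀ (Ioi ε ×ˢ C) = K * G₀ C := by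
  have hfin : ((volume.restrict (Ioi (0 : ℝ))).withDensity
      fun x => ENNReal.ofReal (Real.exp (-x) / x)) (Ioi ε) ≠ ∞ := by
    rw [withDensity_apply _ measurableSet_Ioi, Measure.restrict_restrict measurableSet_Ioi,
      inter_eq_self_of_subset_left (Ioi_subset_Ioi hε.le)]
    refine ((setLIntegral_mono' (g := fun x => ENNReal.ofReal (Real.exp (-1 * x) / ε))
      measurableSet_Ioi fun x (hx : ε < x) => ?_).trans_lt ?_).ne
    · rw [neg_one_mul]
      gcongr
    · exact ((integrableOn_exp_mul_Ioi neg_one_lt_zero ε).div_const ε).lintegral_lt_top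
  lift (ENNReal.ofReal θ * _ : ℝ≥0∞) to ℝ≥0 using
    ENNReal.mul_ne_top ENNReal.ofReal_ne_top hfin with K hK
  refine ⟨K, fun C => ?_⟩
  rw [hK, gammaIntensity, Measure.smul_apply, Measure.prod_prod, smul_eq_mul, mul_assoc]

variable {Ω : Type*} [MeasurableSpace Ω] {μ : Measure Ω} [IsProbabilityMeasure μ]
  {p : ℕ → Ω → ℝ × S} [MeasurableSpace.CountablySeparated S]

/-- Two distinct points with the same location would fall, for every `m`, in a common cell of the
partition of `S` by the first `m` bits of a separating map; the expected number of such
coincidences is of the order of the sum of the squared masses of the cells. -/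
lemma ae_locations_ne_of_le_prod {ν : Measure (ℝ × S)}
    (hN : IsPoissonRandomMeasure μ (fun ω => pointMeasure fun k => p k ω) ν) {B : Set ℝ}
    (hB : MeasurableSet B) (ρ : Measure S) [IsFiniteMeasure ρ] [NullSingletonClass ρ]
    (hν : ∀ C, MeasurableSet C → ν (B ×ˢ C) ≤ ρ C) :
    ∀ᵐ ω ∂μ, ∀ k l, k ≠ l → (p k ω).1 ∈ B → (p l ω).1 ∈ B → (p k ω).2 ≠ (p l ω).2 := by
  have := measurableEq_of_countablySeparated (S := S)
  obtain ⟨f, hf, hinj⟩ := MeasurableSpace.measurable_injection_nat_bool_of_countablySeparated S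
  let cell : (m : ℕ) → (Fin m → Bool) → Set S := fun m v => (fun s (i : Fin m) => f s i) ⁻¹' {v}
  have hcell : ∀ m v, MeasurableSet (cell m v) := fun m v =>
    (by fun_prop : Measurable fun s (i : Fin m) => f s i) (measurableSet_singleton v)
  rw [ae_iff]
  refine le_antisymm (ge_of_tendsto' (tendsto_sum_measure_bits_sq ρ hf hinj) fun m => ?_) zero_le
  calc _ ≤ μ (⋃ v, {ω | pointMeasure (fun k => p k ω) (B ×ˢ cell m v) ∉ ({0, 1} : Set ℝ≥0∞)}) := by
        refine measure_mono fun ω hω => ?_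
        simp only [ne_eq, mem_ofPred_eq, not_forall, not_not] at hω
        obtain ⟨k, l, hkl, hk, hl, hs⟩ := hω
        have hs' : (p l ω).2 ∈ cell m fun i => f (p k ω).2 i := by rw [hs]; rfl
        have htwo := two_le_pointMeasure (p := fun k => p k ω) (hB.prod (hcell m _)) hkl
          ⟨hk, rfl⟩ ⟨hl, hs'⟩
        refine mem_iUnion.2 ⟨fun i => f (p k ω).2 i, ?_⟩
        rintro (h0 | h1)
        · exact absurd (h0 ▸ htwo) (by norm_num)
        · exact absurd (h1 ▸ htwo) (by norm_num)
    _ ≤ ∑ v, μ {ω | pointMeasure (fun k => p k ω) (B ×ˢ cell m v) ∉ ({0, 1} : Set ℝ≥0∞)} :=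
        measure_iUnion_fintype_le _ _
    _ ≤ ∑ v, ρ (cell m v) ^ 2 := Finset.sum_le_sum fun v _ =>
        (hN.measure_apply_notMem_zero_one_le (hB.prod (hcell m v))).trans <|
          pow_le_pow_left' (hν _ (hcell m v)) 2

lemma ae_locations_ne {θ : ℝ} {G₀ : Measure S} [IsFiniteMeasure G₀] [NullSingletonClass G₀]
    (hN : IsPoissonRandomMeasure μ (fun ω => pointMeasure fun k => p k ω) (gammaIntensity θ G₀)) :
    ∀ᵐ ω ∂μ, ∀ k l, k ≠ l → 0 < (p k ω).1 → 0 < (p l ω).1 → (p k ω).2 ≠ (p l ω).2 := by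
  have hε : ∀ m : ℕ, ∀ᵐ ω ∂μ, ∀ k l, k ≠ l → (p k ω).1 ∈ Ioi (1 / (m + 1 : ℝ)) →
      (p l ω).1 ∈ Ioi (1 / (m + 1 : ℝ)) → (p k ω).2 ≠ (p l ω).2 := fun m => by
    obtain ⟨K, hK⟩ := exists_gammaIntensity_Ioi_prod θ G₀ (ε := 1 / (m + 1 : ℝ)) (by positivity)
    have : NullSingletonClass (K • G₀) := ⟨fun s => by simp⟩
    exact ae_locations_ne_of_le_prod hN measurableSet_Ioi (K • G₀) fun C _ => (hK C).le
  filter_upwards [ae_all_iff.2 hε] with ω hω k l hkl hk hl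
  obtain ⟨m, hm⟩ := exists_nat_one_div_lt (lt_min hk hl)
  exact hω m k l hkl (hm.trans_le (min_le_left _ _)) (hm.trans_le (min_le_right _ _))

end DistinctLocations

section AtomMoments

variable {S : Type*} [MeasurableSpace S]

/-- The moment `E[P{X} ^ r]` of the mass of the atom at a symbol `X` drawn from `P`. -/
def atomMoment (r : ℕ) (P : Measure S) : ℝ≥0∞ := ∫⁻ s, P {s} ^ r ∂P

lemma atomMoment_le_one (r : ℕ) (P : Measure S) [IsZeroOrProbabilityMeasure P] :
    atomMoment r P ≤ 1 :=
  calc atomMoment r P ≤ ∫⁻ _, 1 ∂P := lintegral_mono fun _ => pow_le_one' prob_le_one r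
    _ ≤ 1 := lintegral_one.trans_le prob_le_one

lemma atomMoment_cond [MeasurableSingletonClass S] {B : Set S} (hB : MeasurableSet B) (r : ℕ)
    (P : Measure S) : atomMoment r P[|B] = (∫⁻ s in B, P {s} ^ r ∂P) / P B ^ (r + 1) := by
  rcases eq_or_ne (P B) 0 with h0 | h0
  · simp [atomMoment, cond_eq_zero_of_meas_eq_zero h0, Measure.restrict_eq_zero.2 h0]
  · have hc : (P B)⁻¹ ≠ ∞ := ENNReal.inv_ne_top.2 h0
    calc atomMoment r P[|B]
        = (P B)⁻¹ * ∫⁻ s in B, (P B)⁻¹ ^ r * P {s} ^ r ∂P := by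
          rw [atomMoment, ProbabilityTheory.cond, lintegral_smul_measure, smul_eq_mul]
          congr 1
          refine setLIntegral_congr_fun hB fun s hs => ?_
          rw [Measure.smul_apply, Measure.restrict_apply (measurableSet_singleton s),
            inter_eq_left.2 (singleton_subset_iff.2 hs), smul_eq_mul, mul_pow]
      _ = (∫⁻ s in B, P {s} ^ r ∂P) / P B ^ (r + 1) := by
          rw [lintegral_const_mul' _ _ (ENNReal.pow_ne_top hc), ← mul_assoc, ← pow_succ',
            ← ENNReal.inv_pow, mul_comm, div_eq_mul_inv]

lemma measurable_atomMoment_cond [MeasurableEq S] {B : Set S} (hB : MeasurableSet B) (r : ℕ) :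
    Measurable fun P : Measure S => atomMoment r P[|B] := by
  let κ : Kernel (Measure S) S :=
    ⟨fun P => P[|B], Measure.measurable_of_measurable_coe _ fun A hA => by
      simp_rw [cond_apply hB]
      exact (Measure.measurable_coe hB).inv.mul (Measure.measurable_coe (hB.inter hA))⟩
  have : IsFiniteKernel κ := ⟨1, ENNReal.one_lt_top, fun P => prob_le_one (μ := P[|B])⟩
  have hatom : Measurable fun x : Measure S × S => κ x.1 {x.2} :=
    Kernel.measurable_kernel_prodMk_left (κ := κ.comap Prod.fst measurable_fst)
      (t := {y | y.2 = y.1.2})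
      (measurableSet_eq_fun measurable_snd (measurable_snd.comp measurable_fst))
  exact Measurable.lintegral_kernel_prod_right' (κ := κ) (hatom.pow_const r)

lemma cond_smul (P : Measure S) {a : ℝ≥0∞} (ha0 : a ≠ 0) (ha : a ≠ ∞) (B : Set S) :
    (a • P)[|B] = P[|B] := by
  rw [ProbabilityTheory.cond, ProbabilityTheory.cond, Measure.smul_apply, Measure.restrict_smul,
    smul_smul, smul_eq_mul, ENNReal.mul_inv (Or.inl ha0) (Or.inl ha), mul_right_comm,
    ENNReal.inv_mul_cancel ha0 ha, one_mul]

lemma lintegral_pointMeasure (p : ℕ → ℝ × S) {f : ℝ × S → ℝ≥0∞} (hf : Measurable f) :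
    ∫⁻ x, f x ∂(pointMeasure p) = ∑' k, f (p k) := by
  simp_rw [pointMeasure, lintegral_sum_measure, lintegral_dirac' _ hf]

lemma lintegral_jumpMeasure [MeasurableSingletonClass S] (p : ℕ → ℝ × S) (f : S → ℝ≥0∞) :
    ∫⁻ s, f s ∂(jumpMeasure p) = ∑' k, ENNReal.ofReal (p k).1 * f (p k).2 := by
  simp [jumpMeasure, lintegral_sum_measure, lintegral_smul_measure]

lemma jumpMeasure_apply (p : ℕ → ℝ × S) {A : Set S} (hA : MeasurableSet A) :
    jumpMeasure p A = ∑' k, ENNReal.ofReal (p k).1 * A.indicator 1 (p k).2 := by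
  simp [jumpMeasure, Measure.sum_apply _ hA, Measure.dirac_apply' _ hA]

lemma jumpMeasure_preimage (p : ℕ → ℝ × S) {J : ℕ} {h : S → Fin J} (hh : Measurable h)
    (j : Fin J) : jumpMeasure p (h ⁻¹' {j}) = ∫⁻ x, jumpPower h j 1 x ∂(pointMeasure p) := by
  rw [jumpMeasure_apply p (hh (measurableSet_singleton j)),
    lintegral_pointMeasure p (measurable_jumpPower hh j 1)]
  refine tsum_congr fun k => ?_
  by_cases hj : h (p k).2 = j <;> simp [jumpPower, hj]

variable [MeasurableSingletonClass S] {p : ℕ → ℝ × S}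

lemma jumpMeasure_singleton
    (hp : ∀ k l, k ≠ l → 0 < (p k).1 → 0 < (p l).1 → (p k).2 ≠ (p l).2) {k : ℕ}
    (hk : 0 < (p k).1) : jumpMeasure p {(p k).2} = ENNReal.ofReal (p k).1 := by
  rw [jumpMeasure_apply p (measurableSet_singleton _), tsum_eq_single k fun l hl => ?_]
  · simp
  · rcases le_or_gt (p l).1 0 with hl0 | hl0
    · simp [ENNReal.ofReal_of_nonpos hl0]
    · simp [hp l k hl hl0 hk]

lemma setLIntegral_jumpMeasure_singleton_pow
    (hp : ∀ k l, k ≠ l → 0 < (p k).1 → 0 < (p l).1 → (p k).2 ≠ (p l).2) {J : ℕ}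
    {h : S → Fin J} (hh : Measurable h) (j : Fin J) (r : ℕ) :
    ∫⁻ s in h ⁻¹' {j}, jumpMeasure p {s} ^ r ∂(jumpMeasure p) =
      ∫⁻ x, jumpPower h j (r + 1) x ∂(pointMeasure p) := by
  rw [← lintegral_indicator (hh (measurableSet_singleton j)), lintegral_jumpMeasure,
    lintegral_pointMeasure p (measurable_jumpPower hh j _)]
  refine tsum_congr fun k => ?_
  rcases le_or_gt (p k).1 0 with hk | hk
  · simp [jumpPower, ENNReal.ofReal_of_nonpos hk]
  · by_cases hj : h (p k).2 = j <;>
      simp [jumpPower, hj, jumpMeasure_singleton hp hk, pow_succ']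

end AtomMoments

section DirichletProcess

variable {S : Type*} [MeasurableSpace S]

/-- The normalization `μ̃ / μ̃(S)` of the discrete measure `μ̃ = ∑ₖ Jₖ δ_Sₖ`. -/
def normalizedJumpMeasure (p : ℕ → ℝ × S) : Measure S :=
  (jumpMeasure p univ)⁻¹ • jumpMeasure p

variable {Ω : Type*} [MeasurableSpace Ω] {p : ℕ → Ω → ℝ × S}

lemma measurable_normalizedJumpMeasure (hp : ∀ k, Measurable (p k)) :
    Measurable fun ω => normalizedJumpMeasure fun k => p k ω := by
  have happly : ∀ A, MeasurableSet A → Measurable fun ω => jumpMeasure (fun k => p k ω) A :=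
    fun A hA => by
      simp_rw [jumpMeasure_apply _ hA]
      have : Measurable (A.indicator (1 : S → ℝ≥0∞)) := measurable_one.indicator hA
      fun_prop
  exact Measure.measurable_of_measurable_coe _ fun A hA =>
    (happly univ .univ).inv.mul (happly A hA)

lemma measurable_bucketProb {J : ℕ} {h : S → Fin J} (hh : Measurable h) :
    Measurable fun P : Measure S => bucketProb h P :=
  measurable_pi_lambda _ fun j =>
    (Measure.measurable_coe (hh (measurableSet_singleton j))).ennreal_toReal

variable {μ : Measure Ω} [IsProbabilityMeasure μ] {θ : ℝ} {G₀ : Measure S} [IsFiniteMeasure G₀]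
  {J : ℕ} {h : S → Fin J}

lemma ae_jumpMeasure_preimage
    (hN : IsPoissonRandomMeasure μ (fun ω => pointMeasure fun k => p k ω) (gammaIntensity θ G₀))
    (hh : Measurable h) (hα : ∀ j, 0 ≤ bucketShape θ G₀ h j) :
    ∀ᵐ ω ∂μ, ∀ j, jumpMeasure (fun k => p k ω) (h ⁻¹' {j}) =
      bucketMass (fun ω => pointMeasure fun k => p k ω) h ω j :=
  (ae_coe_bucketMass hN hh hα).mono fun ω hω j => by rw [jumpMeasure_preimage _ hh, hω]

lemma ae_jumpMeasure_univ
    (hN : IsPoissonRandomMeasure μ (fun ω => pointMeasure fun k => p k ω) (gammaIntensity θ G₀))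
    (hh : Measurable h) (hα : ∀ j, 0 ≤ bucketShape θ G₀ h j) :
    ∀ᵐ ω ∂μ, jumpMeasure (fun k => p k ω) univ =
      ∑ j, (bucketMass (fun ω => pointMeasure fun k => p k ω) h ω j : ℝ≥0∞) := by
  filter_upwards [ae_jumpMeasure_preimage hN hh hα] with ω hω
  simp_rw [← hω]
  rw [sum_measure_preimage_singleton _ fun j _ => hh (measurableSet_singleton j),
    Finset.coe_univ, preimage_univ]

lemma ae_jumpMeasure_univ_ne
    (hN : IsPoissonRandomMeasure μ (fun ω => pointMeasure fun k => p k ω) (gammaIntensity θ G₀))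
    (hh : Measurable h) (hα : ∀ j, 0 < bucketShape θ G₀ h j) (j : Fin J) :
    ∀ᵐ ω ∂μ, jumpMeasure (fun k => p k ω) univ ≠ 0 ∧ jumpMeasure (fun k => p k ω) univ ≠ ∞ := by
  filter_upwards [ae_jumpMeasure_univ hN hh fun j => (hα j).le,
    ae_bucketMass_ne_zero hN hh hα] with ω huniv hne
  rw [huniv, ← ENNReal.ofNNReal_finsetSum]
  refine ⟨fun hsum => hne j ?_, ENNReal.coe_ne_top⟩
  exact Finset.sum_eq_zero_iff.1 (ENNReal.coe_eq_zero.1 hsum) j (Finset.mem_univ j)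

lemma ae_bucketProb_normalizedJumpMeasure
    (hN : IsPoissonRandomMeasure μ (fun ω => pointMeasure fun k => p k ω) (gammaIntensity θ G₀))
    (hh : Measurable h) (hα : ∀ j, 0 ≤ bucketShape θ G₀ h j) :
    ∀ᵐ ω ∂μ, bucketProb h (normalizedJumpMeasure fun k => p k ω) =
      fun j => (bucketMass (fun ω => pointMeasure fun k => p k ω) h ω j : ℝ) /
        ∑ i, (bucketMass (fun ω => pointMeasure fun k => p k ω) h ω i : ℝ) := by
  filter_upwards [ae_jumpMeasure_preimage hN hh hα, ae_jumpMeasure_univ hN hh hα]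
    with ω hbucket huniv
  ext j
  rw [bucketProb, normalizedJumpMeasure, measureReal_ennreal_smul_apply, measureReal_def, hbucket,
    huniv, ← ENNReal.ofNNReal_finsetSum]
  simp only [ENNReal.toReal_inv, ENNReal.coe_toReal, NNReal.coe_sum, div_eq_inv_mul]

lemma ae_atomMoment_cond_normalizedJumpMeasure [MeasurableSpace.CountablySeparated S]
    [NullSingletonClass G₀]
    (hN : IsPoissonRandomMeasure μ (fun ω => pointMeasure fun k => p k ω) (gammaIntensity θ G₀))
    (hh : Measurable h) (hα : ∀ j, 0 < bucketShape θ G₀ h j) (j : Fin J) (r : ℕ) :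
    ∀ᵐ ω ∂μ, atomMoment r (normalizedJumpMeasure fun k => p k ω)[|h ⁻¹' {j}] =
      (∫⁻ x, jumpPower h j (r + 1) x ∂(pointMeasure fun k => p k ω)) /
        (bucketMass (fun ω => pointMeasure fun k => p k ω) h ω j) ^ (r + 1) := by
  have := measurableEq_of_countablySeparated (S := S)
  filter_upwards [ae_jumpMeasure_preimage hN hh fun j => (hα j).le,
    ae_jumpMeasure_univ_ne hN hh hα j, ae_locations_ne hN] with ω hbucket huniv hloc
  rw [normalizedJumpMeasure,
    cond_smul _ (ENNReal.inv_ne_zero.2 huniv.2) (ENNReal.inv_ne_top.2 huniv.1),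
    atomMoment_cond (hh (measurableSet_singleton j)), hbucket,
    setLIntegral_jumpMeasure_singleton_pow hloc hh]

namespace IsDirichletProcessLaw

variable {Q : Measure (Measure S)}

lemma ae_isProbabilityMeasure_and_preimage_ne_zero (hQ : IsDirichletProcessLaw θ G₀ Q)
    (hh : Measurable h) (hα : ∀ j, 0 < bucketShape θ G₀ h j) (j : Fin J) :
    ∀ᵐ P ∂Q, IsProbabilityMeasure P ∧ P (h ⁻¹' {j}) ≠ 0 := by
  obtain ⟨Ω, _, μ, _, p, hp, hN, rfl⟩ := hQ
  have hm : MeasurableSet {P : Measure S | P univ = 1 ∧ P (h ⁻¹' {j}) ≠ 0} :=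
    (Measure.measurable_coe .univ (measurableSet_singleton 1)).inter <|
      Measure.measurable_coe (hh (measurableSet_singleton j)) (measurableSet_singleton 0).compl
  have hae : ∀ᵐ ω ∂μ, (normalizedJumpMeasure fun k => p k ω) univ = 1 ∧
      (normalizedJumpMeasure fun k => p k ω) (h ⁻¹' {j}) ≠ 0 := by
    filter_upwards [ae_jumpMeasure_preimage hN hh fun j => (hα j).le,
      ae_jumpMeasure_univ_ne hN hh hα j, ae_bucketMass_ne_zero hN hh hα] with ω hbucket huniv hne
    refine ⟨ENNReal.inv_mul_cancel huniv.1 huniv.2, mul_ne_zero ?_ ?_⟩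
    · exact ENNReal.inv_ne_zero.2 huniv.2
    · exact hbucket j ▸ ENNReal.coe_ne_zero.2 (hne j)
  exact ((ae_map_iff (measurable_normalizedJumpMeasure hp).aemeasurable hm).2 hae).mono
    fun P hP => ⟨⟨hP.1⟩, hP.2⟩

lemma setLIntegral_atomMoment_cond [MeasurableSpace.CountablySeparated S]
    [NullSingletonClass G₀] (hQ : IsDirichletProcessLaw θ G₀ Q) (hh : Measurable h)
    (hα : ∀ j, 0 < bucketShape θ G₀ h j) (j : Fin J) (r : ℕ) {A : Set (Fin J → ℝ)}
    (hA : MeasurableSet A) :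
    ∫⁻ P in bucketProb h ⁻¹' A, atomMoment r P[|h ⁻¹' {j}] ∂Q =
      ENNReal.ofReal (weightMoment (bucketShape θ G₀ h j) r) * Q (bucketProb h ⁻¹' A) := by
  have := measurableEq_of_countablySeparated (S := S)
  obtain ⟨Ω, _, μ, _, p, hp, hN, rfl⟩ := hQ
  have hB := hh (measurableSet_singleton j)
  have hΦ := measurable_normalizedJumpMeasure hp
  have hqA := measurable_bucketProb hh hA
  let g : (Fin J → ℝ≥0) → Fin J → ℝ := fun t i => t i / ∑ l, (t l : ℝ)
  have hgA : MeasurableSet (g ⁻¹' A) := (by fun_prop : Measurable g) hA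
  let T := bucketMass (fun ω => pointMeasure fun k => p k ω) h
  have hset : (fun ω => normalizedJumpMeasure fun k => p k ω) ⁻¹' (bucketProb h ⁻¹' A) =ᵐ[μ]
      T ⁻¹' (g ⁻¹' A) :=
    (ae_bucketProb_normalizedJumpMeasure hN hh fun j => (hα j).le).mono fun ω hω =>
      congrArg (· ∈ A) hω
  rw [show (fun ω => (jumpMeasure (fun k => p k ω) univ)⁻¹ • jumpMeasure fun k => p k ω) =
      fun ω => normalizedJumpMeasure fun k => p k ω from rfl,
    setLIntegral_map hqA (measurable_atomMoment_cond hB r) hΦ, Measure.map_apply hΦ hqA,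
    setLIntegral_congr hset, measure_congr hset,
    ← setLIntegral_jumpPower_div_bucketMass hN hh hα j r hgA]
  exact lintegral_congr_ae <| ae_restrict_of_ae <|
    ae_atomMoment_cond_normalizedJumpMeasure hN hh hα j r

end IsDirichletProcessLaw

end DirichletProcess

section ConditionalExpectation

variable {Ω : Type*} {m m₀ : MeasurableSpace Ω} {μ : Measure Ω}

lemma condExp_toReal_of_setLIntegral_eq [IsFiniteMeasure μ] {f : Ω → ℝ≥0∞} {a : ℝ≥0∞}
    (hm : m ≤ m₀) (hf : Measurable f) (ha : a ≠ ∞)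
    (h : ∀ s, MeasurableSet[m] s → ∫⁻ x in s, f x ∂μ = a * μ s) :
    μ[fun x => (f x).toReal | m] =ᵐ[μ] fun _ => a.toReal := by
  have hfin : ∀ s, MeasurableSet[m] s → ∫⁻ x in s, f x ∂μ ≠ ∞ := fun s hs =>
    h s hs ▸ ENNReal.mul_ne_top ha (measure_ne_top μ s)
  have hint : Integrable (fun x => (f x).toReal) μ :=
    integrable_toReal_of_lintegral_ne_top hf.aemeasurable <|
      setLIntegral_univ (μ := μ) f ▸ hfin univ (@MeasurableSet.univ _ m)
  refine (ae_eq_condExp_of_forall_setIntegral_eq hm hint (fun _ _ _ => integrableOn_const)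
    (fun s hs _ => ?_) aestronglyMeasurable_const).symm
  rw [integral_toReal hf.aemeasurable (ae_lt_top hf (hfin s hs)), h s hs, setIntegral_const,
    ENNReal.toReal_mul, smul_eq_mul, mul_comm, measureReal_def]

lemma condExp_sum_mul_of_condExp_const {ι : Type*} {s : Finset ι} {w f : ι → Ω → ℝ} {a : ι → ℝ}
    (hw : ∀ i ∈ s, StronglyMeasurable[m] (w i)) (hf : ∀ i ∈ s, Integrable (f i) μ)
    (hwf : ∀ i ∈ s, Integrable (w i * f i) μ) (h : ∀ i ∈ s, μ[f i | m] =ᵐ[μ] fun _ => a i) :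
    μ[fun x => ∑ i ∈ s, w i x * f i x | m] =ᵐ[μ] fun x => ∑ i ∈ s, w i x * a i := by
  have hterm : ∀ᵐ x ∂μ, ∀ i ∈ s, (μ[w i * f i | m]) x = w i x * a i :=
    (ae_ball_iff s.countable_toSet).2 fun i hi => by
      filter_upwards [condExp_mul_of_stronglyMeasurable_left (hw i hi) (hwf i hi) (hf i hi),
        h i hi] with x hpull hconst
      rw [hpull, Pi.mul_apply, hconst]
  rw [show (fun x => ∑ i ∈ s, w i x * f i x) = ∑ i ∈ s, w i * f i by ext x; simp]
  filter_upwards [condExp_finsetSum hwf m, hterm] with x hsum hterm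
  rw [hsum, Finset.sum_apply, Finset.sum_congr rfl hterm]

end ConditionalExpectation

section WeightMoment

lemma beta_sub_beta_add_one {a b : ℝ} (ha : 0 < a) (hb : 0 < b) :
    beta a b - beta (a + 1) b = beta a (b + 1) := by
  have := Real.Gamma_pos_of_pos (add_pos ha hb)
  rw [beta, beta, beta, ← add_assoc, add_right_comm, Real.Gamma_add_one ha.ne',
    Real.Gamma_add_one hb.ne', Real.Gamma_add_one (add_pos ha hb).ne']
  field_simp
  ring

lemma fwdDiff_iter_beta {a b : ℝ} (ha : 0 < a) (hb : 0 < b) (m : ℕ) :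
    (fwdDiff 1)^[m] (fun k : ℕ => beta (a + k) b) =
      fun k : ℕ => (-1) ^ m * beta (a + k) (b + m) := by
  induction m with
  | zero => simp
  | succ m ih =>
    ext k
    rw [Function.iterate_succ_apply', ih, fwdDiff, Nat.cast_succ, Nat.cast_succ, ← add_assoc,
      ← add_assoc b, ← beta_sub_beta_add_one (by positivity) (by positivity)]
    ring

lemma sum_choose_mul_neg_one_pow_mul_beta {a b : ℝ} (ha : 0 < a) (hb : 0 < b) (m : ℕ) :
    ∑ k ∈ Finset.range (m + 1), (m.choose k : ℝ) * (-1) ^ k * beta (a + k) b = beta a (b + m) := by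
  have hdiff := fwdDiff_iter_eq_sum_shift 1 (fun k : ℕ => beta (a + k) b) m 0
  simp only [fwdDiff_iter_beta ha hb] at hdiff
  calc ∑ k ∈ Finset.range (m + 1), (m.choose k : ℝ) * (-1) ^ k * beta (a + k) b
      = (-1) ^ m * ((-1) ^ m * beta (a + (0 : ℕ)) (b + m)) := by
        rw [hdiff, Finset.mul_sum]
        refine Finset.sum_congr rfl fun k hk => ?_
        have hkm : k ≤ m := Nat.lt_succ_iff.1 (Finset.mem_range.1 hk)
        obtain ⟨l, rfl⟩ := Nat.exists_eq_add_of_le hkm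
        have hsign : (-1 : ℝ) ^ (k + l) * (-1) ^ l = (-1) ^ k := by
          rw [pow_add, mul_assoc, ← mul_pow]
          simp
        simp only [add_tsub_cancel_left, zsmul_eq_mul, Int.cast_mul, Int.cast_pow, Int.cast_neg,
          Int.cast_one, Int.cast_natCast, smul_eq_mul, mul_one, zero_add]
        rw [← hsign]
        ring
    _ = beta a (b + m) := by rw [← mul_assoc, ← mul_pow]; simp

lemma sum_choose_mul_neg_one_pow_mul_weightMoment {α : ℝ} (hα : 0 < α) (m : ℕ) :
    ∑ k ∈ Finset.range (m + 1), (m.choose k : ℝ) * (-1) ^ k * weightMoment α k = α / (α + m) := by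
  have := Real.Gamma_pos_of_pos (show 0 < α + m by positivity)
  have hbeta : beta 1 (α + m) = 1 / (α + m) := by
    rw [beta, Real.Gamma_one, add_comm 1, Real.Gamma_add_one (by positivity)]
    field_simp
  rw [← mul_one_div α, ← hbeta, ← sum_choose_mul_neg_one_pow_mul_beta one_pos hα, Finset.mul_sum]
  refine Finset.sum_congr rfl fun k _ => ?_
  rw [weightMoment, add_comm (k : ℝ)]
  ring

end WeightMoment

section FreshDraws

variable {S : Type*} [MeasurableSpace S]

/-- The probability that none of `i` independent draws from `P` equals a further one. -/
def freshProb (i : ℕ) (P : Measure S) : ℝ := ∫ s, (1 - P.real {s}) ^ i ∂P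

lemma measurable_measure_singleton [MeasurableEq S] (P : Measure S) [SFinite P] :
    Measurable fun s => P {s} :=
  measurable_measure_prodMk_left (ν := P) (s := {x | x.2 = x.1})
    (measurableSet_eq_fun measurable_snd measurable_fst)

lemma integrable_comp_measureReal_singleton [MeasurableEq S] (P : Measure S) [IsFiniteMeasure P]
    {g : ℝ → ℝ} (hg : Continuous g) : Integrable (fun s => g (P.real {s})) P := by
  obtain ⟨C, hC⟩ := (isCompact_Icc (a := 0) (b := P.real univ)).exists_bound_of_continuousOn
    hg.continuousOn
  exact .of_bound (hg.measurable.comp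
    (measurable_measure_singleton P).ennreal_toReal).aestronglyMeasurable C <|
    ae_of_all _ fun s => hC _ ⟨measureReal_nonneg, measureReal_mono (subset_univ _)⟩

lemma toReal_atomMoment [MeasurableEq S] (k : ℕ) (P : Measure S) [IsFiniteMeasure P] :
    (atomMoment k P).toReal = ∫ s, P.real {s} ^ k ∂P := by
  simp_rw [atomMoment, measureReal_def, ← ENNReal.toReal_pow]
  exact (integral_toReal ((measurable_measure_singleton P).pow_const k).aemeasurable <|
    ae_of_all _ fun s => ENNReal.pow_lt_top (measure_lt_top P {s})).symm

lemma freshProb_eq_sum_atomMoment [MeasurableEq S] (i : ℕ) (P : Measure S) [IsFiniteMeasure P] :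
    freshProb i P =
      ∑ k ∈ Finset.range (i + 1), (i.choose k : ℝ) * (-1) ^ k * (atomMoment k P).toReal := by
  simp_rw [toReal_atomMoment, ← integral_const_mul]
  rw [freshProb, ← integral_finsetSum _ fun k _ =>
    (integrable_comp_measureReal_singleton P (continuous_pow k)).const_mul _]
  refine integral_congr_ae (ae_of_all _ fun s => ?_)
  simp only [sub_eq_neg_add, add_pow, one_pow, mul_one, neg_pow (P.real _)]
  exact Finset.sum_congr rfl fun k _ => by ring

variable [MeasurableEq S] {Q : Measure (Measure S)} [IsFiniteMeasure Q] {B : Set S}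

lemma integrable_atomMoment_cond (hB : MeasurableSet B) (k : ℕ) :
    Integrable (fun P => (atomMoment k P[|B]).toReal) Q :=
  Integrable.of_bound (measurable_atomMoment_cond hB k).ennreal_toReal.aestronglyMeasurable 1 <|
    ae_of_all _ fun P => by
      rw [Real.norm_of_nonneg ENNReal.toReal_nonneg]
      exact ENNReal.toReal_mono ENNReal.one_ne_top (atomMoment_le_one k P[|B])

lemma integrable_freshProb_cond (hB : MeasurableSet B) (i : ℕ) :
    Integrable (fun P => freshProb i P[|B]) Q := by
  simp_rw [freshProb_eq_sum_atomMoment]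
  exact integrable_finsetSum _ fun k _ => (integrable_atomMoment_cond hB k).const_mul _

end FreshDraws

namespace IsDirichletProcessLaw

variable {S : Type*} [MeasurableSpace S] {θ : ℝ} {G₀ : Measure S} {Q : Measure (Measure S)}

lemma isProbabilityMeasure (hQ : IsDirichletProcessLaw θ G₀ Q) : IsProbabilityMeasure Q := by
  obtain ⟨Ω, _, μ, _, p, hp, -, rfl⟩ := hQ
  exact Measure.isProbabilityMeasure_map (measurable_normalizedJumpMeasure hp).aemeasurable

variable [MeasurableSpace.CountablySeparated S] [IsFiniteMeasure G₀] [NullSingletonClass G₀]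
  {J : ℕ} {h : S → Fin J}

lemma condExp_atomMoment_cond (hQ : IsDirichletProcessLaw θ G₀ Q) (hh : Measurable h)
    (hα : ∀ j, 0 < bucketShape θ G₀ h j) (j : Fin J) (r : ℕ) :
    Q[fun P => (atomMoment r P[|h ⁻¹' {j}]).toReal | .comap (bucketProb h) inferInstance] =ᵐ[Q]
      fun _ => weightMoment (bucketShape θ G₀ h j) r := by
  have := hQ.isProbabilityMeasure
  have := measurableEq_of_countablySeparated (S := S)
  rw [← ENNReal.toReal_ofReal (weightMoment_nonneg (hα j) r)]
  refine condExp_toReal_of_setLIntegral_eq (measurable_bucketProb hh).comap_le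
    (measurable_atomMoment_cond (hh (measurableSet_singleton j)) r) ENNReal.ofReal_ne_top ?_
  rintro _ ⟨A, hA, rfl⟩
  exact hQ.setLIntegral_atomMoment_cond hh hα j r hA

lemma condExp_freshProb_cond (hQ : IsDirichletProcessLaw θ G₀ Q) (hh : Measurable h)
    (hα : ∀ j, 0 < bucketShape θ G₀ h j) (j : Fin J) (i : ℕ) :
    Q[fun P => freshProb i P[|h ⁻¹' {j}] | .comap (bucketProb h) inferInstance] =ᵐ[Q]
      fun _ => bucketShape θ G₀ h j / (bucketShape θ G₀ h j + i) := by
  have := measurableEq_of_countablySeparated (S := S)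
  have := hQ.isProbabilityMeasure
  have hB := hh (measurableSet_singleton j)
  simp_rw [freshProb_eq_sum_atomMoment, ← sum_choose_mul_neg_one_pow_mul_weightMoment (hα j)]
  exact condExp_sum_mul_of_condExp_const (w := fun k _ => (i.choose k : ℝ) * (-1) ^ k)
    (fun _ _ => stronglyMeasurable_const) (fun k _ => integrable_atomMoment_cond hB k)
    (fun k _ => (integrable_atomMoment_cond hB k).const_mul _)
    fun k _ => hQ.condExp_atomMoment_cond hh hα j k

end IsDirichletProcessLaw

section Sampling

variable {S : Type*} {J n : ℕ}

open Classical in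
/-- The bucket assignments of `n` symbols whose sketch is `c`. -/
def sketchAssignments (n : ℕ) (c : Fin J → ℕ) : Finset (Fin n → Fin J) :=
  {a | ∀ j, ({i | a i = j} : Finset (Fin n)).card = c j}

lemma sketchAssignments_nonempty {c : Fin J → ℕ} (hc : ∑ j, c j = n) :
    (sketchAssignments n c).Nonempty := by
  classical
  subst hc
  refine ⟨fun i => (finSigmaFinEquiv.symm i).1,
    Finset.mem_filter.2 ⟨Finset.mem_univ _, fun j => ?_⟩⟩
  rw [← Fintype.card_subtype, ← Fintype.card_fin (c j)]
  exact Fintype.card_congr <|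
    (finSigmaFinEquiv.symm.subtypeEquiv fun _ => Iff.rfl).trans (Equiv.sigmaSubtype j)

lemma sketch_eq_iff_mem_sketchAssignments {h : S → Fin J} {c : Fin J → ℕ} {x : Fin (n + 1) → S} :
    sketch h x = c ↔ (fun i : Fin n => h (x i.castSucc)) ∈ sketchAssignments n c := by
  simp only [sketchAssignments, Finset.mem_filter, Finset.mem_univ, true_and]
  exact funext_iff

open Classical in
/-- The weight `u` or `1` of a symbol `x`, according to whether it equals `s`, on the event that it
falls into the bucket `l`; the product over a sample marks the frequency of `s` by a power of
`u`. -/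
def matchWeight (h : S → Fin J) (u : ℝ) (l : Fin J) (s x : S) : ℝ :=
  if h x = l then (if x = s then u else 1) else 0

lemma sum_prod_matchWeight (h : S → Fin J) (u : ℝ) (c : Fin J → ℕ) (x : Fin (n + 1) → S) :
    ∑ a ∈ sketchAssignments n c, ∏ i, matchWeight h u (a i) (x (Fin.last n)) (x i.castSucc) =
      {x | sketch h x = c}.indicator (fun x => u ^ queryFrequency x) x := by
  classical
  have hprod : ∀ a : Fin n → Fin J, ∏ i, matchWeight h u (a i) (x (Fin.last n)) (x i.castSucc) =
      if (fun i => h (x i.castSucc)) = a then u ^ queryFrequency x else 0 := fun a => by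
    by_cases ha : (fun i => h (x i.castSucc)) = a
    · subst ha
      simp [matchWeight, queryFrequency, Finset.prod_ite]
    · obtain ⟨i, hi⟩ := Function.ne_iff.1 ha
      rw [if_neg ha]
      exact Finset.prod_eq_zero (Finset.mem_univ i) (if_neg hi)
  simp_rw [hprod, Finset.sum_ite_eq, indicator_apply, mem_ofPred_eq,
    sketch_eq_iff_mem_sketchAssignments]

lemma matchWeight_eq_indicator_sub (h : S → Fin J) (u : ℝ) (l : Fin J) (s : S) :
    matchWeight h u l s = fun x =>
      (h ⁻¹' {l}).indicator 1 x - (1 - u) * (h ⁻¹' {l} ∩ {s}).indicator 1 x := by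
  classical
  ext x
  rcases eq_or_ne x s with rfl | hx <;> by_cases hl : h x = l <;>
    simp [matchWeight, *]

lemma queryFrequency_le_sketch (h : S → Fin J) (x : Fin (n + 1) → S) :
    queryFrequency x ≤ sketch h x (h (x (Fin.last n))) := by
  classical
  exact Finset.card_le_card <| Finset.monotone_filter_right _ fun _ _ hi => congrArg h hi

variable [MeasurableSpace S]

lemma measurableSet_sketch {h : S → Fin J} (hh : Measurable h) (c : Fin J → ℕ) (j : Fin J) :
    MeasurableSet {x : Fin (n + 1) → S | sketch h x = c ∧ h (x (Fin.last n)) = j} := by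
  have hbuckets : Measurable fun (x : Fin (n + 1) → S) i => h (x i) := by fun_prop
  exact hbuckets (MeasurableSet.of_discrete (s := {b | sketch id b = c ∧ b (Fin.last n) = j}))

lemma measurable_queryFrequency [MeasurableEq S] :
    Measurable (queryFrequency : (Fin (n + 1) → S) → ℕ) := by
  classical
  have hsum : (queryFrequency : (Fin (n + 1) → S) → ℕ) =
      fun x => ∑ i : Fin n, if x i.castSucc = x (Fin.last n) then 1 else 0 := by
    ext x
    rw [queryFrequency, Finset.card_filter]
  rw [hsum]
  exact Finset.measurable_sum _ fun i _ => Measurable.ite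
    (measurableSet_eq_fun (measurable_pi_apply _) (measurable_pi_apply _))
    measurable_const measurable_const

variable (P : Measure S)

section Integrals

variable [MeasurableSingletonClass S] [IsFiniteMeasure P] {h : S → Fin J} (hh : Measurable h)
  (u : ℝ)

include hh

lemma integrable_matchWeight (l : Fin J) (s : S) : Integrable (matchWeight h u l s) P := by
  have hB : MeasurableSet (h ⁻¹' {l}) := hh (measurableSet_singleton l)
  rw [matchWeight_eq_indicator_sub]
  exact ((integrable_const 1).indicator hB).sub
    (((integrable_const 1).indicator (hB.inter (measurableSet_singleton s))).const_mul _)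

lemma integral_matchWeight (l : Fin J) (s : S) :
    ∫ x, matchWeight h u l s x ∂P =
      bucketProb h P l * (1 - (1 - u) * P[|h ⁻¹' {l}].real {s}) := by
  have hB : MeasurableSet (h ⁻¹' {l}) := hh (measurableSet_singleton l)
  have hBs := hB.inter (measurableSet_singleton s)
  have hcond : bucketProb h P l * P[|h ⁻¹' {l}].real {s} = P.real (h ⁻¹' {l} ∩ {s}) := by
    rw [bucketProb, mul_comm, measureReal_def, measureReal_def, ← ENNReal.toReal_mul,
      cond_mul_eq_inter hB, measureReal_def]
  rw [matchWeight_eq_indicator_sub, integral_sub ((integrable_const 1).indicator hB)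
    (((integrable_const 1).indicator hBs).const_mul _), integral_const_mul,
    integral_indicator_one hB, integral_indicator_one hBs, ← hcond, bucketProb]
  ring

lemma integral_prod_matchWeight {c : Fin J → ℕ} {a : Fin n → Fin J}
    (ha : a ∈ sketchAssignments n c) (s : S) :
    ∫ y, ∏ i, matchWeight h u (a i) s (y i) ∂(Measure.pi fun _ : Fin n => P) =
      (∏ l, bucketProb h P l ^ c l) *
        (1 - (1 - u) * P[|h ⁻¹' {h s}].real {s}) ^ c (h s) := by
  classical
  have hother : ∀ l ≠ h s, P[|h ⁻¹' {l}].real {s} = 0 := fun l hl => by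
    have hempty : h ⁻¹' {l} ∩ {s} = ∅ := inter_singleton_eq_empty.2 fun hs => hl hs.symm
    rw [measureReal_def, cond_apply (hh (measurableSet_singleton l)), hempty, measure_empty,
      mul_zero, ENNReal.toReal_zero]
  calc ∫ y, ∏ i, matchWeight h u (a i) s (y i) ∂(Measure.pi fun _ : Fin n => P)
      = ∏ i, bucketProb h P (a i) * (1 - (1 - u) * P[|h ⁻¹' {a i}].real {s}) := by
        rw [integral_fintype_prod_eq_prod (fun i x => matchWeight h u (a i) s x)]
        simp_rw [integral_matchWeight P hh]
    _ = ∏ l, (bucketProb h P l * (1 - (1 - u) * P[|h ⁻¹' {l}].real {s})) ^ c l := by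
        rw [← Finset.prod_fiberwise' _ a fun l =>
          bucketProb h P l * (1 - (1 - u) * P[|h ⁻¹' {l}].real {s})]
        refine Finset.prod_congr rfl fun l _ => ?_
        rw [Finset.prod_const, ← (Finset.mem_filter.1 ha).2 l]
    _ = _ := by
        simp_rw [mul_pow, Finset.prod_mul_distrib]
        congr 1
        refine Finset.prod_eq_single_of_mem _ (Finset.mem_univ _) fun l _ hl => ?_
        rw [hother l hl, mul_zero, sub_zero, one_pow]

end Integrals

lemma integral_pi_eq_integral_integral_snoc [SigmaFinite P] {f : (Fin (n + 1) → S) → ℝ}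
    (hf : Integrable f (Measure.pi fun _ => P)) :
    ∫ x, f x ∂(Measure.pi fun _ => P) =
      ∫ s, ∫ y, f (Fin.snoc y s : Fin (n + 1) → S) ∂(Measure.pi fun _ : Fin n => P) ∂P := by
  have hsnoc := (measurePreserving_piFinSuccAbove (fun _ : Fin (n + 1) => P) (Fin.last n)).symm
  rw [← hsnoc.integral_comp', integral_prod]
  · simp [Fin.snocEquiv]
  · exact hsnoc.integrable_comp_of_integrable hf

lemma setIntegral_pow_queryFrequency [MeasurableEq S] [IsProbabilityMeasure P] {h : S → Fin J}
    (hh : Measurable h) {u : ℝ} (hu : |u| ≤ 1) (c : Fin J → ℕ) (j : Fin J) :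
    ∫ x in {x : Fin (n + 1) → S | sketch h x = c ∧ h (x (Fin.last n)) = j},
        u ^ queryFrequency x ∂(Measure.pi fun _ => P) =
      (sketchAssignments n c).card * (∏ l, bucketProb h P l ^ c l) *
        ∫ s in h ⁻¹' {j}, (1 - (1 - u) * P[|h ⁻¹' {j}].real {s}) ^ c j ∂P := by
  have hA := measurableSet_sketch (n := n) hh c j
  have hint : Integrable (fun x : Fin (n + 1) → S => u ^ queryFrequency x)
      (Measure.pi fun _ => P) :=
    .of_bound (measurable_from_nat.comp measurable_queryFrequency).aestronglyMeasurable 1 <|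
      .of_forall fun x => by
        rw [norm_pow, Real.norm_eq_abs]
        exact pow_le_one₀ (abs_nonneg u) hu
  rw [← integral_indicator hA, integral_pi_eq_integral_integral_snoc P (hint.indicator hA),
    ← integral_indicator (hh (measurableSet_singleton j)), ← integral_const_mul]
  congr 1 with s
  by_cases hs : h s = j
  · subst hs
    have hslice : ∀ y : Fin n → S, {x : Fin (n + 1) → S | sketch h x = c ∧
          h (x (Fin.last n)) = h s}.indicator (fun x => u ^ queryFrequency x) (Fin.snoc y s) =
        ∑ a ∈ sketchAssignments n c, ∏ i, matchWeight h u (a i) s (y i) := fun y => by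
      have hsum := sum_prod_matchWeight h u c (Fin.snoc y s : Fin (n + 1) → S)
      simp only [Fin.snoc_last, Fin.snoc_castSucc] at hsum
      rw [hsum]
      simp [indicator_apply]
    simp_rw [hslice]
    rw [integral_finsetSum _ fun a _ => .fintype_prod fun i =>
        integrable_matchWeight P hh u (a i) s,
      Finset.sum_congr rfl fun a ha => integral_prod_matchWeight P hh u ha s, Finset.sum_const,
      nsmul_eq_mul, indicator_of_mem (show s ∈ h ⁻¹' {h s} from rfl), mul_assoc]
  · simp [hs]

end Sampling

section GoodTuring

lemma sum_mul_measureReal_eq_integral_comp {Ω : Type*} [MeasurableSpace Ω] {μ : Measure Ω}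
    [IsFiniteMeasure μ] {X : Ω → ℕ} (hX : Measurable X) {m : ℕ} (hm : ∀ᵐ ω ∂μ, X ω ≤ m)
    (g : ℕ → ℝ) :
    ∑ r ∈ Finset.range (m + 1), g r * μ.real {ω | X ω = r} = ∫ ω, g (X ω) ∂μ := by
  have hfiber : ∀ r, MeasurableSet {ω | X ω = r} := fun r => hX (measurableSet_singleton r)
  have hsplit : (fun ω => g (X ω)) =ᵐ[μ]
      fun ω => ∑ r ∈ Finset.range (m + 1), g r * {ω | X ω = r}.indicator 1 ω := by
    filter_upwards [hm] with ω hω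
    rw [Finset.sum_eq_single_of_mem (X ω) (Finset.mem_range_succ_iff.2 hω)] <;>
      simp +contextual [eq_comm]
  rw [integral_congr_ae hsplit, integral_finsetSum _ fun r _ =>
    ((integrable_const 1).indicator (hfiber r)).const_mul _]
  simp_rw [integral_const_mul, integral_indicator_one (hfiber _)]

lemma integral_cond {Ω : Type*} [MeasurableSpace Ω] (μ : Measure Ω) (A : Set Ω) (f : Ω → ℝ) :
    ∫ ω, f ω ∂μ[|A] = (μ.real A)⁻¹ * ∫ ω in A, f ω ∂μ := by
  rw [ProbabilityTheory.cond, integral_smul_measure, ENNReal.toReal_inv, smul_eq_mul,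
    measureReal_def]

lemma integral_one_sub_mul_pow (p : ℝ) (m : ℕ) :
    ∫ u in (0 : ℝ)..1, (1 - (1 - u) * p) ^ m =
      1 / ((m : ℝ) + 1) * ∑ i ∈ Finset.range (m + 1), (1 - p) ^ i := by
  rcases eq_or_ne p 0 with rfl | hp
  · simp [inv_mul_cancel₀ (Nat.cast_add_one_ne_zero (R := ℝ) m)]
  · have hgeom := mul_neg_geom_sum (1 - p) (m + 1)
    have hrw : ∀ u : ℝ, 1 - (1 - u) * p = p * u + (1 - p) := fun u => by ring
    simp_rw [hrw]
    rw [intervalIntegral.integral_comp_mul_add (fun x => x ^ m) hp, integral_pow]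
    simp only [mul_one, mul_zero, zero_add, add_sub_cancel, one_pow, smul_eq_mul]
    rw [← hgeom]
    field_simp
    ring

lemma integrable_one_sub_mul_measureReal_singleton_pow {S : Type*} [MeasurableSpace S]
    [MeasurableEq S] (ν : Measure S) [IsZeroOrProbabilityMeasure ν] (m : ℕ) :
    Integrable (Function.uncurry fun (u : ℝ) s => (1 - (1 - u) * ν.real {s}) ^ m)
      ((volume.restrict (uIoc 0 1)).prod ν) := by
  have hatom : Measurable fun s => ν.real {s} := (measurable_measure_singleton ν).ennreal_toReal
  have hmeas : Measurable (Function.uncurry fun (u : ℝ) s => (1 - (1 - u) * ν.real {s}) ^ m) :=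
    (measurable_const.sub <| (measurable_const.sub measurable_fst).mul <|
      hatom.comp measurable_snd).pow_const _
  have hunit : ∀ᵐ z ∂(volume.restrict (Ioc (0 : ℝ) 1)).prod ν, z.1 ∈ Ioc (0 : ℝ) 1 :=
    Measure.quasiMeasurePreserving_fst.ae (ae_restrict_mem measurableSet_Ioc)
  rw [uIoc_of_le zero_le_one]
  refine .of_bound hmeas.aestronglyMeasurable 1 ?_
  filter_upwards [hunit] with z hz
  refine (norm_pow _ _).trans_le (pow_le_one₀ (norm_nonneg _) (abs_le.2 ⟨?_, ?_⟩)) <;>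
    nlinarith [hz.1, hz.2, measureReal_nonneg (μ := ν) (s := {z.2}),
      measureReal_le_one (μ := ν) (s := {z.2})]

/-- The conditional mean of `1 / (f + 1)` for the frequency `f` of a query in bucket `j`, given the
sketch `c`. -/
def meanInvFrequency {S : Type*} [MeasurableSpace S] {J : ℕ} (h : S → Fin J) (n : ℕ)
    (c : Fin J → ℕ) (j : Fin J) (P : Measure S) : ℝ :=
  ∑ r ∈ Finset.range (c j + 1), 1 / ((r : ℝ) + 1) * frequencyProb h n c j r P

variable {S : Type*} [MeasurableSpace S] [MeasurableEq S] {J n : ℕ} {P : Measure S}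
  [IsProbabilityMeasure P] {h : S → Fin J} (hh : Measurable h) {c : Fin J → ℕ}
  (hP : ∀ l, bucketProb h P l ≠ 0) (hc : ∑ l, c l = n)

include hh hP hc

lemma sum_pow_mul_frequencyProb {u : ℝ} (hu : |u| ≤ 1) (j : Fin J) :
    ∑ r ∈ Finset.range (c j + 1), u ^ r * frequencyProb h n c j r P =
      ∫ s, (1 - (1 - u) * P[|h ⁻¹' {j}].real {s}) ^ c j ∂P[|h ⁻¹' {j}] := by
  have hA := measurableSet_sketch (n := n) hh c j
  have hbound : ∀ᵐ x ∂(Measure.pi fun _ : Fin (n + 1) => P)[|{x | sketch h x = c ∧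
      h (x (Fin.last n)) = j}], queryFrequency x ≤ c j := by
    filter_upwards [ae_cond_mem hA] with x hx
    exact hx.2 ▸ hx.1 ▸ queryFrequency_le_sketch h x
  have hmass : (Measure.pi fun _ : Fin (n + 1) => P).real {x | sketch h x = c ∧
      h (x (Fin.last n)) = j} =
      (sketchAssignments n c).card * (∏ l, bucketProb h P l ^ c l) * bucketProb h P j := by
    simpa [bucketProb] using setIntegral_pow_queryFrequency (n := n) P hh (u := 1) (by simp) c j
  have hcard : ((sketchAssignments n c).card : ℝ) ≠ 0 :=
    Nat.cast_ne_zero.2 (sketchAssignments_nonempty hc).card_ne_zero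
  have hprod : ∏ l, bucketProb h P l ^ c l ≠ 0 :=
    Finset.prod_ne_zero_iff.2 fun l _ => pow_ne_zero _ (hP l)
  simp_rw [frequencyProb]
  rw [sum_mul_measureReal_eq_integral_comp measurable_queryFrequency hbound fun r => u ^ r,
    integral_cond, integral_cond, hmass, setIntegral_pow_queryFrequency P hh hu, ← bucketProb]
  field_simp [hP j]

/-- Good–Turing: the factor `1 / (r + 1)` is `∫ u in 0..1, u ^ r`, and integrating the generating
function of the frequency produces a geometric sum. -/
lemma meanInvFrequency_eq_sum_freshProb (j : Fin J) :
    meanInvFrequency h n c j P =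
      1 / ((c j : ℝ) + 1) * ∑ i ∈ Finset.range (c j + 1), freshProb i P[|h ⁻¹' {j}] := by
  set ν := P[|h ⁻¹' {j}]
  calc meanInvFrequency h n c j P
      = ∫ u in (0 : ℝ)..1, ∑ r ∈ Finset.range (c j + 1), u ^ r * frequencyProb h n c j r P := by
        rw [meanInvFrequency, intervalIntegral.integral_finsetSum fun r _ =>
          (by fun_prop : Continuous _).intervalIntegrable 0 1]
        simp_rw [intervalIntegral.integral_mul_const, integral_pow]
        simp
    _ = ∫ u in (0 : ℝ)..1, ∫ s, (1 - (1 - u) * ν.real {s}) ^ c j ∂ν := by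
        refine intervalIntegral.integral_congr fun u hu => ?_
        rw [uIcc_of_le zero_le_one] at hu
        exact sum_pow_mul_frequencyProb hh hP hc (abs_le.2 ⟨by linarith [hu.1], hu.2⟩) j
    _ = ∫ s, (∫ u in (0 : ℝ)..1, (1 - (1 - u) * ν.real {s}) ^ c j) ∂ν :=
        intervalIntegral_integral_swap (integrable_one_sub_mul_measureReal_singleton_pow ν (c j))
    _ = _ := by
        simp_rw [integral_one_sub_mul_pow, integral_const_mul]
        rw [integral_finsetSum _ fun i _ => integrable_comp_measureReal_singleton ν
          (by fun_prop : Continuous fun p : ℝ => (1 - p) ^ i)]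
        rfl

end GoodTuring

section Universality

variable {S H : Type*} [MeasurableSpace S] [MeasurableSpace H] {J : ℕ}

namespace IsStronglyUniversalFor

variable {G₀ : Measure S} [IsProbabilityMeasure G₀] {lam : Measure H} {h : H → S → Fin J}
  (hmeas : Measurable (Function.uncurry h))

include hmeas

lemma memLp_bucketProb [IsFiniteMeasure lam] (j : Fin J) :
    MemLp (fun ι => bucketProb (h ι) G₀ j) 2 lam :=
  .of_bound (measurable_measure_prodMk_left (ν := G₀)
    (hmeas (measurableSet_singleton j))).ennreal_toReal.aestronglyMeasurable 1 <|
    ae_of_all _ fun _ => (Real.norm_of_nonneg measureReal_nonneg).trans_le measureReal_le_one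

variable (huniv : IsStronglyUniversalFor lam h G₀)

include huniv

lemma integral_bucketProb_mul_bucketProb (j l : Fin J) :
    ∫ ι, bucketProb (h ι) G₀ j * bucketProb (h ι) G₀ l ∂lam = ((J : ℝ) ^ 2)⁻¹ := by
  have hpair : MeasurableSet {z : H × S × S | h z.1 z.2.1 = j ∧ h z.1 z.2.2 = l} :=
    (hmeas.comp (measurable_fst.prodMk measurable_snd.fst) (measurableSet_singleton j)).inter
      (hmeas.comp (measurable_fst.prodMk measurable_snd.snd) (measurableSet_singleton l))
  have hslice : ∀ ι, bucketProb (h ι) G₀ j * bucketProb (h ι) G₀ l =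
      ((G₀.prod G₀) (Prod.mk ι ⁻¹' {z | h z.1 z.2.1 = j ∧ h z.1 z.2.2 = l})).toReal := fun ι => by
    rw [bucketProb, bucketProb, measureReal_def, measureReal_def, ← ENNReal.toReal_mul,
      ← Measure.prod_prod]
    rfl
  simp_rw [hslice]
  rw [integral_toReal (measurable_measure_prodMk_left hpair).aemeasurable
      (ae_of_all _ fun _ => measure_lt_top _ _), ← Measure.prod_apply hpair, huniv j l]
  simp

lemma integral_bucketProb [IsFiniteMeasure lam] (j : Fin J) :
    ∫ ι, bucketProb (h ι) G₀ j ∂lam = (J : ℝ)⁻¹ := by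
  have hsum : ∀ ι, bucketProb (h ι) G₀ j = ∑ l, bucketProb (h ι) G₀ j * bucketProb (h ι) G₀ l :=
    fun ι => by
      have hι : Measurable (h ι) := hmeas.comp measurable_prodMk_left
      simp_rw [← Finset.mul_sum, bucketProb]
      rw [sum_measureReal_preimage_singleton _ fun l _ => hι (measurableSet_singleton l)]
      simp
  have hint : ∀ l, Integrable (fun ι => bucketProb (h ι) G₀ j * bucketProb (h ι) G₀ l) lam :=
    fun l => (memLp_bucketProb hmeas j).integrable_mul (memLp_bucketProb hmeas l)
  rw [integral_congr_ae (ae_of_all _ hsum), integral_finsetSum _ fun l _ => hint l]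
  simp_rw [integral_bucketProb_mul_bucketProb hmeas huniv]
  have hJ : (J : ℝ) ≠ 0 := Nat.cast_ne_zero.2 j.pos.ne'
  simp only [Finset.sum_const, Finset.card_univ, Fintype.card_fin, nsmul_eq_mul]
  field_simp

/-- The second moment of a bucket probability is the square of its mean, so its variance
vanishes. -/
lemma ae_bucketProb_eq [IsProbabilityMeasure lam] :
    ∀ᵐ ι ∂lam, ∀ j, bucketProb (h ι) G₀ j = (J : ℝ)⁻¹ := by
  refine ae_all_iff.2 fun j => ?_
  have hvar : Var[fun ι => bucketProb (h ι) G₀ j; lam] = 0 := by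
    rw [variance_eq_sub (memLp_bucketProb hmeas j), integral_bucketProb hmeas huniv j]
    simp only [Pi.pow_apply, pow_two, integral_bucketProb_mul_bucketProb hmeas huniv j j]
    rw [mul_inv, sub_self]
  filter_upwards [ae_eq_integral_of_variance_eq_zero (memLp_bucketProb hmeas j) hvar] with ι hι
  rw [hι, integral_bucketProb hmeas huniv j]

end IsStronglyUniversalFor

end Universality

section Digamma

lemma digamma_add_one {x : ℝ} (hx : 0 < x) : digamma (x + 1) = digamma x + 1 / x := by
  have hdiff : DifferentiableAt ℝ (fun y : ℝ => Real.log (Real.Gamma y)) x :=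
    (Real.differentiableAt_Gamma fun m => by linarith [m.cast_nonneg (α := ℝ)]).log
      (Real.Gamma_pos_of_pos hx).ne'
  have hfun : (fun y : ℝ => Real.log (Real.Gamma (y + 1))) =ᶠ[𝓝 x]
      fun y => Real.log y + Real.log (Real.Gamma y) := by
    filter_upwards [lt_mem_nhds hx] with y hy
    rw [Real.Gamma_add_one hy.ne', Real.log_mul hy.ne' (Real.Gamma_pos_of_pos hy).ne']
  rw [digamma, ← deriv_comp_add_const (fun y : ℝ => Real.log (Real.Gamma y)), hfun.deriv_eq,
    deriv_fun_add (Real.differentiableAt_log hx.ne') hdiff, Real.deriv_log, digamma, one_div,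
    add_comm]

lemma digamma_natCast_add_sub_digamma {x : ℝ} (hx : 0 < x) (m : ℕ) :
    digamma (m + x) - digamma x = ∑ i ∈ Finset.range m, 1 / (i + x) := by
  induction m with
  | zero => simp
  | succ m ih =>
    rw [Finset.sum_range_succ, ← ih, Nat.cast_succ, add_right_comm,
      digamma_add_one (by positivity)]
    ring

end Digamma

section Estimator

variable {S : Type*} [MeasurableSpace S] {θ : ℝ} {G₀ : Measure S} {Q : Measure (Measure S)}
  {n J : ℕ} {h : S → Fin J} {c : Fin J → ℕ}

namespace IsDirichletProcessLaw

section

variable [MeasurableEq S] [IsFiniteMeasure G₀] (hQ : IsDirichletProcessLaw θ G₀ Q)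
  (hh : Measurable h) (hα : ∀ j, 0 < bucketShape θ G₀ h j) (hc : ∑ j, c j = n)

include hQ hh hα hc

lemma ae_meanInvFrequency_eq (j : Fin J) :
    meanInvFrequency h n c j =ᵐ[Q] fun P =>
      ∑ i ∈ Finset.range (c j + 1), 1 / ((c j : ℝ) + 1) * freshProb i P[|h ⁻¹' {j}] := by
  filter_upwards [ae_all_iff.2 fun l => hQ.ae_isProbabilityMeasure_and_preimage_ne_zero hh hα l]
    with P hP
  have := (hP j).1
  rw [meanInvFrequency_eq_sum_freshProb hh (fun l => (measureReal_ne_zero_iff).2 (hP l).2) hc j,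
    Finset.mul_sum]

lemma integrable_meanInvFrequency (j : Fin J) :
    Integrable (meanInvFrequency h n c j) Q := by
  have := hQ.isProbabilityMeasure
  exact (integrable_finsetSum _ fun i _ => (integrable_freshProb_cond
    (hh (measurableSet_singleton j)) i).const_mul _).congr
    (hQ.ae_meanInvFrequency_eq hh hα hc j).symm

lemma integrable_bucketProb_mul_meanInvFrequency (j : Fin J) :
    Integrable (fun P => bucketProb h P j * meanInvFrequency h n c j P) Q := by
  refine (hQ.integrable_meanInvFrequency hh hα hc j).bdd_mul (c := 1)
    ((measurable_pi_apply j).comp (measurable_bucketProb hh)).aestronglyMeasurable ?_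
  filter_upwards [hQ.ae_isProbabilityMeasure_and_preimage_ne_zero hh hα j] with P hP
  have := hP.1
  exact (Real.norm_of_nonneg measureReal_nonneg).trans_le measureReal_le_one

lemma integrable_cardinalityFunctional (q : Fin J → ℝ) :
    Integrable (fun P => cardinalityFunctional h n c q P) Q :=
  (integrable_finsetSum _ fun j _ =>
    (hQ.integrable_meanInvFrequency hh hα hc j).const_mul (q j)).const_mul _

lemma integrable_epsilonK : Integrable (fun P => epsilonK h n c P) Q :=
  (integrable_finsetSum _ fun j _ =>
    hQ.integrable_bucketProb_mul_meanInvFrequency hh hα hc j).const_mul _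

end

variable [MeasurableSpace.CountablySeparated S] [IsFiniteMeasure G₀] [NullSingletonClass G₀]
  (hQ : IsDirichletProcessLaw θ G₀ Q) (hh : Measurable h) (hα : ∀ j, 0 < bucketShape θ G₀ h j)
  (hc : ∑ j, c j = n)

include hQ hh hα hc

lemma condExp_meanInvFrequency (j : Fin J) :
    Q[meanInvFrequency h n c j | .comap (bucketProb h) inferInstance] =ᵐ[Q] fun _ =>
      bucketShape θ G₀ h j / (1 + c j) *
        (digamma (1 + c j + bucketShape θ G₀ h j) - digamma (bucketShape θ G₀ h j)) := by
  have := measurableEq_of_countablySeparated (S := S)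
  have := hQ.isProbabilityMeasure
  have hB := hh (measurableSet_singleton j)
  refine (condExp_congr_ae (hQ.ae_meanInvFrequency_eq hh hα hc j)).trans <|
    (condExp_sum_mul_of_condExp_const (w := fun _ _ => 1 / ((c j : ℝ) + 1))
      (fun _ _ => stronglyMeasurable_const) (fun i _ => integrable_freshProb_cond hB i)
      (fun i _ => (integrable_freshProb_cond hB i).const_mul _)
      fun i _ => hQ.condExp_freshProb_cond hh hα j i).trans (ae_of_all _ fun P => ?_)
  have hdigamma := digamma_natCast_add_sub_digamma (hα j) (c j + 1)
  rw [Nat.cast_add_one, add_comm (c j : ℝ)] at hdigamma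
  rw [hdigamma, Finset.mul_sum]
  exact Finset.sum_congr rfl fun i _ => by ring

lemma integral_meanInvFrequency (j : Fin J) :
    ∫ P, meanInvFrequency h n c j P ∂Q = bucketShape θ G₀ h j / (1 + c j) *
      (digamma (1 + c j + bucketShape θ G₀ h j) - digamma (bucketShape θ G₀ h j)) := by
  have := hQ.isProbabilityMeasure
  rw [← integral_condExp (measurable_bucketProb hh).comap_le,
    integral_congr_ae (hQ.condExp_meanInvFrequency hh hα hc j), integral_const, probReal_univ,
    one_smul]

lemma integral_cardinalityFunctional (q : Fin J → ℝ) :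
    ∫ P, cardinalityFunctional h n c q P ∂Q =
      n * ∑ j, q j * (bucketShape θ G₀ h j / (1 + c j) *
        (digamma (1 + c j + bucketShape θ G₀ h j) - digamma (bucketShape θ G₀ h j))) := by
  have := measurableEq_of_countablySeparated (S := S)
  have hfun : ∀ P, cardinalityFunctional h n c q P = n * ∑ j, q j * meanInvFrequency h n c j P :=
    fun _ => rfl
  simp_rw [hfun]
  rw [integral_const_mul, integral_finsetSum _ fun j _ =>
    (hQ.integrable_meanInvFrequency hh hα hc j).const_mul (q j)]
  simp_rw [integral_const_mul, hQ.integral_meanInvFrequency hh hα hc]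

lemma condExp_epsilonK :
    Q[fun P => epsilonK h n c P | .comap (bucketProb h) inferInstance] =ᵐ[Q] fun P =>
      n * ∑ j, bucketProb h P j * (bucketShape θ G₀ h j / (1 + c j) *
        (digamma (1 + c j + bucketShape θ G₀ h j) - digamma (bucketShape θ G₀ h j))) := by
  have := measurableEq_of_countablySeparated (S := S)
  have hw : ∀ j, Measurable[.comap (bucketProb h) inferInstance] fun P => bucketProb h P j :=
    fun j => (measurable_pi_apply j).comp (comap_measurable (bucketProb h))
  have hfun : (fun P => epsilonK h n c P) =
      (n : ℝ) • fun P => ∑ j, bucketProb h P j * meanInvFrequency h n c j P := rfl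
  rw [hfun]
  filter_upwards [condExp_smul (μ := Q) (n : ℝ)
      (fun P => ∑ j, bucketProb h P j * meanInvFrequency h n c j P)
      (.comap (bucketProb h) inferInstance),
    condExp_sum_mul_of_condExp_const (s := Finset.univ) (w := fun j P => bucketProb h P j)
      (fun j _ => (hw j).stronglyMeasurable)
      (fun j _ => hQ.integrable_meanInvFrequency hh hα hc j)
      (fun j _ => hQ.integrable_bucketProb_mul_meanInvFrequency hh hα hc j)
      fun j _ => hQ.condExp_meanInvFrequency hh hα hc j] with P hsmul hsum
  rw [hsmul, Pi.smul_apply, hsum, smul_eq_mul]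

end IsDirichletProcessLaw

end Estimator

end SketchDP

end

theorem proposition4_general
    {S : Type*} [MeasurableSpace S] [MeasurableSpace.CountablySeparated S]
    {H : Type*} [MeasurableSpace H] {n J : ℕ} {θ : ℝ} (hθ : 0 < θ)
    {G₀ : Measure S} [IsProbabilityMeasure G₀] [NullSingletonClass G₀]
    {lam : Measure H} [IsProbabilityMeasure lam]
    {h : H → S → Fin J} (hmeas : Measurable (Function.uncurry h))
    (huniv : IsStronglyUniversalFor lam h G₀)
    {Q : Measure (Measure S)} (hQ : IsDirichletProcessLaw θ G₀ Q)
    {c : Fin J → ℕ} (hc : ∑ j, c j = n) :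
    ∀ᵐ ι ∂lam,
      (∀ q : Fin J → ℝ,
        Integrable (fun P => cardinalityFunctional (h ι) n c q P) Q ∧
        ∫ P, cardinalityFunctional (h ι) n c q P ∂Q =
          n * (θ / J) * ∑ j, q j / (1 + c j) *
            (digamma (1 + c j + θ / J) - digamma (θ / J))) ∧
      (Integrable (fun P => epsilonK (h ι) n c P) Q ∧
        Q[fun P => epsilonK (h ι) n c P |
            MeasurableSpace.comap (bucketProb (h ι)) inferInstance] =ᵐ[Q]
          fun P => n * (θ / J) * ∑ j, bucketProb (h ι) P j / (1 + c j) *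
            (digamma (1 + c j + θ / J) - digamma (θ / J))) := by
  have := measurableEq_of_countablySeparated (S := S)
  filter_upwards [huniv.ae_bucketProb_eq hmeas] with ι hι
  have hh : Measurable (h ι) := hmeas.comp measurable_prodMk_left
  have hshape : ∀ j, bucketShape θ G₀ (h ι) j = θ / J := fun j => by
    rw [bucketShape, hι, div_eq_mul_inv]
  have hα : ∀ j, 0 < bucketShape θ G₀ (h ι) j := fun j => by
    rw [hshape]
    exact div_pos hθ (Nat.cast_pos.2 j.pos)
  have hsum : ∀ q : Fin J → ℝ, (n : ℝ) * ∑ j, q j * (bucketShape θ G₀ (h ι) j / (1 + c j) *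
        (digamma (1 + c j + bucketShape θ G₀ (h ι) j) - digamma (bucketShape θ G₀ (h ι) j))) =
      n * (θ / J) * ∑ j, q j / (1 + c j) * (digamma (1 + c j + θ / J) - digamma (θ / J)) :=
    fun q => by
      simp_rw [hshape, mul_assoc, Finset.mul_sum]
      exact Finset.sum_congr rfl fun j _ => by ring
  refine ⟨fun q => ⟨hQ.integrable_cardinalityFunctional hh hα hc q, ?_⟩,
    hQ.integrable_epsilonK hh hα hc, ?_⟩
  · rw [hQ.integral_cardinalityFunctional hh hα hc, hsum]
  · exact (hQ.condExp_epsilonK hh hα hc).trans (ae_of_all _ fun P => hsum (bucketProb (h ι) P))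

theorem proposition4
    {S : Type*} [MeasurableSpace S] [StandardBorelSpace S]
    {H : Type*} [MeasurableSpace H]
    (n J : ℕ) (hn : 1 ≤ n) (hJ : 1 ≤ J)
    (θ : ℝ) (hθ : 0 < θ)
    (G₀ : Measure S) [IsProbabilityMeasure G₀] [NullSingletonClass G₀]
    (lam : Measure H) [IsProbabilityMeasure lam]
    (h : H → S → Fin J) (hmeas : Measurable (Function.uncurry h))
    (huniv : IsStronglyUniversalFor lam h G₀)
    (Q : Measure (Measure S)) (hQ : IsDirichletProcessLaw θ G₀ Q)
    (c : Fin J → ℕ) (hc : ∑ j, c j = n) :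
    ∀ᵐ ι ∂lam,
      (∀ q : Fin J → ℝ,
        Integrable (fun P => cardinalityFunctional (h ι) n c q P) Q ∧
        ∫ P, cardinalityFunctional (h ι) n c q P ∂Q =
          n * (θ / J) * ∑ j, q j / (1 + c j) *
            (digamma (1 + c j + θ / J) - digamma (θ / J))) ∧
      (Integrable (fun P => epsilonK (h ι) n c P) Q ∧
        Q[fun P => epsilonK (h ι) n c P |
            MeasurableSpace.comap (bucketProb (h ι)) inferInstance] =ᵐ[Q]
          fun P => n * (θ / J) * ∑ j, bucketProb (h ι) P j / (1 + c j) *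
            (digamma (1 + c j + θ / J) - digamma (θ / J))) :=
  proposition4_general hθ hmeas huniv hQ hc
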